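/- **Setting (Monotone bandits with $M$ players and plays of variable duration).** There are $n$ arms and $M\ge 1$ players; time is discrete. Arm $i$ has a finite nonempty state set $\mathcal S_i$. For $k\in\mathcal S_i$ there are given a reward $r^i_k\ge 0$, a duration $L^i_k\in\{1,2,\dots\}$, numbers $q^i(k,j)\ge 0$ with $\sum_{j\ne k}q^i(k,j)\le 1$, and a nondecreasing function $f^i_k:\{1,2,\dots\}\to[0,1]$ that is piecewise linear with a finite set $\mathcal W^i_k\ni 1$ of positive integer breakpoints (linear between consecutive breakpoints, constant from the last one on). For each $i$ the directed graph on $\mathcal S_i$ with an edge $(j,k)$ whenever $q^i(j,k)>0$ is strongly connected. At every step each free player may begin to play an arm that is not being played. A play of arm $i$ begun in state $k$ earns $r^i_k$ once, at its beginning, and occupies the player and the arm for $L^i_k$ steps; if it began $t\ge 1$ steps after the end of the previous play of the arm, then at its end the arm moves to $j\ne k$ with probability $q^i(k,j)f^i_k(t)$ and otherwise stays in $k$, independently for different arms. Arms that are not played keep their state and earn nothing. Policies may be randomized and history-dependent. At the start all arms are idle with $t=1$, and their states are chosen by the policy. $R_T$ denotes the total reward of the first $T$ steps. **Balanced LP.**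 For real variables $\lambda$, $h_i$, $p^i_k$ put $\Delta P^i_k=\sum_{j\ne k}q^i(k,j)(p^i_j-p^i_k)$. (Balance) is: minimize $M\lambda+\sum_i h_i$ subject to $L^i_k(\lambda+h_i)+(t-1)h_i\ge r^i_k+f^i_k(t)\Delta P^i_k$ for all $i$, $k\in\mathcal S_i$, $t\in\mathcal W^i_k$; $\;M\lambda=\sum_i h_i$; $\;\lambda,h_i\ge 0$. **BalancedIndex policy.** Fix an optimal solution of (Balance). Let $U_1$ be the set of arms $i$ such that playing $i$ over and over from some start state gives average reward at least $\lambda+h_i$ per step, and let $U_2$ be the set of arms $i\notin U_1$ with $h_i>0$. For $i\in U_2$, a state $k$ is *good* if $\Delta P^i_k<0$; an arm $i\in U_2$ in a state $k$ with $\Delta P^i_k\ge 0$ whose last play ended $t$ steps ago is *ready* if $t\ge t^i_k$, where $t^i_k$ is the smallest $t\in\mathcal W^i_k$ for which the constraint for $i,k,t$ is tight. The policy continuously plays $\min(M,|U_1|)$ fixed arms of $U_1$, each begun in a start state as above. If $|U_1|<M$, it starts with at most $M-|U_1|$ arms of $U_2$ in good states, and the remaining free players at each step choose among the arms of $U_2$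 that are not being played: first arms in good states; if none is left, ready arms; if none is left either, they idle. No other arm is played. Ties are broken arbitrarily. **Theorem.** (Balance) has an optimal solution. For every optimal solution there is a BalancedIndex policy, and every BalancedIndex policy is a 2-approximation: its reward satisfies $$2\,\liminf_{T\to\infty}\frac{\mathbb E[R_T]}{T}\;\ge\;\limsup_{T\to\infty}\frac{\mathbb E[R'_T]}{T}$$ for the reward $R'_T$ of any policy from any start states. Moreover $2\liminf_{T\to\infty}\mathbb E[R_T]/T$ is at least the optimal value of Whittle's linear program: maximize $\sum_{i}\sum_{k\in\mathcal S_i}\sum_{t\ge1}r^i_kx^i_{kt}$ subject to $x\ge 0$, $\sum_{i,k,t}L^i_kx^i_{kt}\le M$, $\sum_{k,t}(t+L^i_k-1)x^i_{kt}\le 1$ for all $i$, and $\sum_{j\ne k}\sum_t x^i_{kt}q^i(k,j)f^i_k(t)=\sum_{j\ne k}\sum_t x^i_{jt}q^i(j,k)f^i_j(t)$ for all $i$ and $k\in\mathcal S_i$. -/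

import Mathlib

open Filter

noncomputable section

/-- A Monotone bandit with `n` arms, `M` players and plays of variable duration.
Arm `i` has the states `Fin (K i)`.  Only the values `f i k t` with `t ≥ 1` and the
off-diagonal entries of `q i` are relevant. -/
structure MonotoneBandit (n : ℕ) (K : Fin n → ℕ) where
  /-- number of players -/
  M : ℕ
  M_pos : 1 ≤ M
  K_pos : ∀ i, 1 ≤ K i
  /-- reward for a play of arm `i` in state `k` -/
  r : ∀ i, Fin (K i) → ℝ
  r_nonneg : ∀ i k, 0 ≤ r i k
  /-- number of steps for which a play of arm `i` in state `k` blocks the player -/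
  L : ∀ i, Fin (K i) → ℕ
  L_pos : ∀ i k, 1 ≤ L i k
  /-- distribution of the new state, conditioned on the escape from the old one -/
  q : ∀ i, Fin (K i) → Fin (K i) → ℝ
  q_nonneg : ∀ i k j, 0 ≤ q i k j
  q_sum_le : ∀ i k, ∑ j with j ≠ k, q i k j ≤ 1
  /-- the directed graph of the positive entries of `q i` is strongly connected -/
  q_connected : ∀ i k j, Relation.ReflTransGen (fun a b => 0 < q i a b) k j
  /-- escape probability from state `k` when the last play ended `t` steps ago -/
  f : ∀ i, Fin (K i) → ℕ → ℝ
  f_nonneg : ∀ i k t, 1 ≤ t → 0 ≤ f i k t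
  f_le_one : ∀ i k t, 1 ≤ t → f i k t ≤ 1
  f_mono : ∀ i k t, 1 ≤ t → f i k t ≤ f i k (t + 1)
  /-- the finite set of breakpoints of the piecewise linear function `f i k` -/
  W : ∀ i, Fin (K i) → Finset ℕ
  W_pos : ∀ i k, ∀ t ∈ W i k, 1 ≤ t
  one_mem_W : ∀ i k, 1 ∈ W i k
  /-- `f i k` is linear between two consecutive breakpoints -/
  f_interp : ∀ i k, ∀ t₁ ∈ W i k, ∀ t₂ ∈ W i k, t₁ < t₂ →
    (∀ s ∈ W i k, ¬ (t₁ < s ∧ s < t₂)) → ∀ t, t₁ ≤ t → t ≤ t₂ →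
      f i k t = (((t₂ : ℝ) - t) * f i k t₁ + ((t : ℝ) - t₁) * f i k t₂) / ((t₂ : ℝ) - t₁)
  /-- `f i k` is constant from the last breakpoint on -/
  f_tail : ∀ i k, ∀ t₁ ∈ W i k, (∀ s ∈ W i k, s ≤ t₁) → ∀ t, t₁ ≤ t → f i k t = f i k t₁

/-- Situation of one arm at the beginning of a time step.  If `rem = 0` the arm is idle
(not being played), and its previous play ended `elapsed ≥ 1` steps ago.  If `rem ≥ 1` the arm
is blocked by a running play that occupies it for `rem` more steps (including the coming one),
and that began when the previous play had ended `elapsed` steps before. -/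
structure ArmStatus (m : ℕ) where
  state : Fin m
  elapsed : ℕ
  rem : ℕ

/-- Joint situation of all arms at the beginning of a time step. -/
abbrev BanditConfig {n : ℕ} (K : Fin n → ℕ) : Type := ∀ i, ArmStatus (K i)

/-- The past: situations and actions (sets of arms on which a play was begun), latest first. -/
abbrev BanditHistory {n : ℕ} (K : Fin n → ℕ) : Type := List (BanditConfig K × Finset (Fin n))

/-- Variables of the balanced linear program. -/
structure DualSolution {n : ℕ} (K : Fin n → ℕ) where
  lam : ℝ
  h : Fin n → ℝ
  p : ∀ i, Fin (K i) → ℝ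

namespace MonotoneBandit

variable {n : ℕ} {K : Fin n → ℕ} (B : MonotoneBandit n K)

/-! ### The controlled process -/

/-- Probability that arm `i` is in state `j` at the end of a play in state `k` that began when
the previous play had ended `t` steps before. -/
def trans (i : Fin n) (k : Fin (K i)) (t : ℕ) (j : Fin (K i)) : ℝ :=
  if j = k then 1 - ∑ l with l ≠ k, q B i k l * f B i k t else q B i k j * f B i k t

/-- Number of steps (including the coming one) for which the arm is occupied, once it has been
decided whether a play of the arm is begun now. -/
def occupied (i : Fin n) (c : ArmStatus (K i)) (play : Prop) [Decidable play] : ℕ :=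
  if c.rem = 0 then (if play then B.L i c.state else 0) else c.rem

/-- Probability that the state of arm `i` after the coming step is `j`: a transition happens
exactly if a play ends with this step. -/
def armProb (i : Fin n) (c : ArmStatus (K i)) (play : Prop) [Decidable play]
    (j : Fin (K i)) : ℝ :=
  if B.occupied i c play = 1 then B.trans i c.state c.elapsed j
  else if j = c.state then 1 else 0

/-- Situation of arm `i` after the coming step, if its state is then `j`. -/
def armNext (i : Fin n) (c : ArmStatus (K i)) (play : Prop) [Decidable play]
    (j : Fin (K i)) : ArmStatus (K i) :=
  if B.occupied i c play = 0 then ⟨c.state, c.elapsed + 1, 0⟩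
  else if B.occupied i c play = 1 then ⟨j, 1, 0⟩
  else ⟨c.state, c.elapsed, B.occupied i c play - 1⟩

/-- Joint situation after the coming step if plays are begun on the arms in `a` and the new
states are `s`. -/
def next (c : BanditConfig K) (a : Finset (Fin n)) (s : ∀ i, Fin (K i)) : BanditConfig K :=
  fun i => B.armNext i (c i) (i ∈ a) (s i)

/-- The arms evolve independently. -/
def jointProb (c : BanditConfig K) (a : Finset (Fin n)) (s : ∀ i, Fin (K i)) : ℝ :=
  ∏ i, B.armProb i (c i) (i ∈ a) (s i)

/-- A play earns its reward when it begins. -/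
def reward (c : BanditConfig K) (a : Finset (Fin n)) : ℝ :=
  ∑ i ∈ a, B.r i (c i).state

/-- The arms on which a play is running. -/
def busy (c : BanditConfig K) : Finset (Fin n) :=
  Finset.univ.filter fun i => (c i).rem ≠ 0

/-- Plays may be begun on idle arms only, and on at most as many as there are free players. -/
def Legal (c : BanditConfig K) (a : Finset (Fin n)) : Prop :=
  (∀ i ∈ a, (c i).rem = 0) ∧ a.card ≤ B.M - (busy c).card

/-- A history-dependent, randomized policy: the distribution of the set of arms on which plays
are begun, given the past and the present situation. -/
structure Policy where
  law : BanditHistory K → BanditConfig K → PMF (Finset (Fin n))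
  legal : ∀ H c a, law H c a ≠ 0 → B.Legal c a

/-- At the start all arms are idle, in the chosen states. -/
def start (s : ∀ i, Fin (K i)) : BanditConfig K := fun i => ⟨s i, 1, 0⟩

variable {B}

/-- Expected total reward of the next `T` steps, given the past `H` and the present situation
`c` (by the law of total expectation over the action and the new states). -/
def Policy.value (π : B.Policy) : ℕ → BanditHistory K → BanditConfig K → ℝ
  | 0, _, _ => 0
  | T + 1, H, c => ∑ a : Finset (Fin n), (π.law H c a).toReal *
      (B.reward c a +
        ∑ s : (∀ i, Fin (K i)), B.jointProb c a s * π.value T ((c, a) :: H) (B.next c a s))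

/-- Expected average reward per step in the first `T` steps, from the start states `s`. -/
def Policy.average (π : B.Policy) (s : ∀ i, Fin (K i)) (T : ℕ) : ℝ :=
  π.value T [] (start s) / T

/-- The pasts and situations that occur with positive probability. -/
inductive Policy.Reachable (π : B.Policy) (s : ∀ i, Fin (K i)) :
    BanditHistory K → BanditConfig K → Prop
  | init : Policy.Reachable π s [] (start s)
  | step (H : BanditHistory K) (c : BanditConfig K) (a : Finset (Fin n))
      (s' : ∀ i, Fin (K i)) : Policy.Reachable π s H c → π.law H c a ≠ 0 →
      0 < B.jointProb c a s' → Policy.Reachable π s ((c, a) :: H) (B.next c a s')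

variable (B)

/-! ### The linear programs -/

/-- Expected change of the potential `p` at an escape from state `k` of arm `i`. -/
def deltaP (D : DualSolution K) (i : Fin n) (k : Fin (K i)) : ℝ :=
  ∑ j with j ≠ k, B.q i k j * (D.p i j - D.p i k)

/-- Feasibility for the balanced linear program. -/
structure BalanceFeasible (D : DualSolution K) : Prop where
  main : ∀ i k, ∀ t ∈ B.W i k,
    B.r i k + B.f i k t * B.deltaP D i k ≤
      (B.L i k : ℝ) * (D.lam + D.h i) + ((t : ℝ) - 1) * D.h i
  balance : (B.M : ℝ) * D.lam = ∑ i, D.h i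
  lam_nonneg : 0 ≤ D.lam
  h_nonneg : ∀ i, 0 ≤ D.h i

/-- Objective of the balanced linear program. -/
def balanceObj (D : DualSolution K) : ℝ := (B.M : ℝ) * D.lam + ∑ i, D.h i

/-- Optimal solutions of the balanced linear program (a minimization). -/
def BalanceOptimal (D : DualSolution K) : Prop :=
  B.BalanceFeasible D ∧ ∀ D', B.BalanceFeasible D' → B.balanceObj D ≤ B.balanceObj D'

/-- Feasibility for Whittle's linear program, with variables `x i k t`, `t ≥ 1`; the variables
`x i k 0` are dummies with value `0`.  For `x ≥ 0`, the summability expresses that the left side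
of `idle` is finite, and it implies that all the series below converge. -/
structure WhittleFeasible (x : ∀ i, Fin (K i) → ℕ → ℝ) : Prop where
  nonneg : ∀ i k t, 0 ≤ x i k t
  zero : ∀ i k, x i k 0 = 0
  summable : ∀ i k, Summable fun t : ℕ => (t : ℝ) * x i k t
  players : ∑ i, ∑ k, ∑' t : ℕ, (B.L i k : ℝ) * x i k t ≤ B.M
  idle : ∀ i, ∑ k, ∑' t : ℕ, ((t : ℝ) + B.L i k - 1) * x i k t ≤ 1
  flow : ∀ i k,
    ∑ j with j ≠ k, ∑' t : ℕ, x i k t * B.q i k j * B.f i k t =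
      ∑ j with j ≠ k, ∑' t : ℕ, x i j t * B.q i j k * B.f i j t

/-- Objective of Whittle's linear program (a maximization). -/
def whittleObj (x : ∀ i, Fin (K i) → ℕ → ℝ) : ℝ :=
  ∑ i, ∑ k, ∑' t : ℕ, B.r i k * x i k t

/-! ### The balanced index policy -/

/-- Expected reward in `T` steps from playing arm `i` over and over, beginning in state `k`;
each play begins `1` step after the end of the previous one. -/
def repeatValue (i : Fin n) : ℕ → Fin (K i) → ℝ
  | 0, _ => 0
  | T + 1, k => B.r i k + ∑ j, B.trans i k 1 j * repeatValue i (T + 1 - B.L i k) j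
termination_by T _ => T
decreasing_by
  have := B.L_pos i k
  omega

/-- Playing arm `i` over and over from state `k` has average reward at least `λ + h_i`
per step. -/
def Lucrative (D : DualSolution K) (i : Fin n) (k : Fin (K i)) : Prop :=
  D.lam + D.h i ≤ liminf (fun T : ℕ => B.repeatValue i T k / (T : ℝ)) atTop

open Classical in
/-- The arms that are lucrative from a suitable start state. -/
def U₁ (D : DualSolution K) : Finset (Fin n) :=
  Finset.univ.filter fun i => ∃ k, B.Lucrative D i k

open Classical in
/-- The remaining arms with `h_i > 0`. -/
def U₂ (D : DualSolution K) : Finset (Fin n) :=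
  Finset.univ.filter fun i => i ∉ B.U₁ D ∧ 0 < D.h i

/-- The constraint of the balanced program for `i`, `k`, `t` holds with equality. -/
def Tight (D : DualSolution K) (i : Fin n) (k : Fin (K i)) (t : ℕ) : Prop :=
  (B.L i k : ℝ) * (D.lam + D.h i) + ((t : ℝ) - 1) * D.h i =
    B.r i k + B.f i k t * B.deltaP D i k

/-- State `k` of arm `i` is good (an exploitation state). -/
def Good (D : DualSolution K) (i : Fin n) (k : Fin (K i)) : Prop := B.deltaP D i k < 0

/-- Arm `i`, in the state `k` that is not good and with the last play `t` steps ago, is ready: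
`t` is at least the smallest breakpoint `t^i_k` whose constraint is tight. -/
def Ready (D : DualSolution K) (i : Fin n) (k : Fin (K i)) (t : ℕ) : Prop :=
  0 ≤ B.deltaP D i k ∧ ∃ t₀, IsLeast {u | u ∈ B.W i k ∧ B.Tight D i k u} t₀ ∧ t₀ ≤ t

/-- The arm is in `U₂`, is idle, and is in a good state. -/
def AvailGood (D : DualSolution K) (c : BanditConfig K) (i : Fin n) : Prop :=
  i ∈ B.U₂ D ∧ (c i).rem = 0 ∧ B.Good D i (c i).state

/-- The arm is in `U₂`, is idle, and is ready. -/
def AvailReady (D : DualSolution K) (c : BanditConfig K) (i : Fin n) : Prop :=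
  i ∈ B.U₂ D ∧ (c i).rem = 0 ∧ B.Ready D i (c i).state (c i).elapsed

/-- The rules for the set `a` of arms on which plays are begun in situation `c`, when `A` is the
selected set of `min(M, |U₁|)` arms of `U₁`. -/
structure BalancedIndexAction (D : DualSolution K) (A : Finset (Fin n))
    (c : BanditConfig K) (a : Finset (Fin n)) : Prop where
  /-- the arms in `A` are played continuously -/
  continuous : ∀ i ∈ A, (c i).rem = 0 → i ∈ a
  /-- other arms are played only if `|U₁| < M` and the arm is good or ready -/
  only : ∀ i ∈ a, i ∈ A ∨ ((B.U₁ D).card < B.M ∧ (B.AvailGood D c i ∨ B.AvailReady D c i))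
  /-- exploit: a ready arm is played only if no good arm is left over -/
  exploit : (∃ i ∈ a, B.AvailReady D c i) → ∀ j, B.AvailGood D c j → j ∈ a
  /-- idle: a player remains idle only if no good or ready arm is left over -/
  idle : (B.U₁ D).card < B.M → a.card < B.M - (busy c).card →
    ∀ j, B.AvailGood D c j ∨ B.AvailReady D c j → j ∈ a

open Classical in
/-- `π`, begun in the states `s`, is a balanced index policy for the solution `D` of the balanced
program; ties are broken arbitrarily. -/
def IsBalancedIndex (D : DualSolution K) (s : ∀ i, Fin (K i)) (π : B.Policy) : Prop :=
  ∃ A : Finset (Fin n), A ⊆ B.U₁ D ∧ A.card = min B.M (B.U₁ D).card ∧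
    (∀ i ∈ A, B.Lucrative D i (s i)) ∧
    ((B.U₁ D).card < B.M →
      ((B.U₂ D).filter fun i => B.Good D i (s i)).card ≤ B.M - (B.U₁ D).card) ∧
    ∀ H c a, π.Reachable s H c → π.law H c a ≠ 0 → B.BalancedIndexAction D A c a

end MonotoneBandit

end

/-!
For a feasible solution of (Balance), let an idle arm in state `k` whose last play ended `t` steps
ago have the potential `p^i_k + (t - 1) h_i`. By the constraints, which extend from the breakpoints
to all `t` because `f^i_k` is piecewise linear, the reward of a step plus the expected change of
the potential is at most `λ` for each playing player plus `h_i` for each arm. Hence no policy earns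
more than `M λ + ∑ h_i = 2 M λ` per step on average, and the same weak duality bounds Whittle's
program.

For an optimal solution each arm of `U₂` has a tight constraint in each of its states, namely the
one for `t = 1` in the good ones: otherwise, the graph of the arm being strongly connected, its
potentials could be adjusted until all its constraints are slack, and the slack could be
distributed over all arms to decrease `λ`. If the credit `(t - 1) h_i` is now capped at the time
when the arm becomes ready, then a step either gains at least `λ` for each player not bound to an
arm of `U₁`, or it gains `h_i` for each arm of `U₂`. Together with the gain `λ + h_i` from each arm
of `U₁` that is played, this is at least `M λ`, since `M λ = ∑ h_i`.
-/

section LinearProgram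

variable {𝕜 E ι : Type*} [Field 𝕜] [LinearOrder 𝕜] [AddCommGroup E] [Module 𝕜 E]

/-- The polyhedron cut out by the equations `a i x = b i` for `i ∈ e` and the inequalities
`b i ≤ a i x` for `i ∈ s`.  Equations are kept apart because the proof that linear programs attain
their optimum turns inequalities into equations one at a time. -/
def polyhedron (a : ι → Module.Dual 𝕜 E) (b : ι → 𝕜) (e s : Set ι) : Set E :=
  {x | (∀ i ∈ e, a i x = b i) ∧ ∀ i ∈ s, b i ≤ a i x}

variable {a : ι → Module.Dual 𝕜 E} {b : ι → 𝕜} {e s : Set ι} {c : Module.Dual 𝕜 E}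

theorem polyhedron_insert_subset (j : ι) : polyhedron a b e (insert j s) ⊆ polyhedron a b e s :=
  fun _ hx => ⟨hx.1, fun i hi => hx.2 i (Set.mem_insert_of_mem j hi)⟩

theorem polyhedron_insert_eq_subset (j : ι) :
    polyhedron a b (insert j e) s ⊆ polyhedron a b e (insert j s) := by
  refine fun x hx => ⟨fun i hi => hx.1 i (Set.mem_insert_of_mem j hi), ?_⟩
  rintro i (rfl | hi)
  exacts [(hx.1 i (Set.mem_insert i e)).ge, hx.2 i hi]

variable [IsStrictOrderedRing 𝕜]

theorem le_of_bddBelow_image_polyhedron_empty (hc : BddBelow (c '' polyhedron a b e ∅)) {x y : E}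
    (hx : x ∈ polyhedron a b e ∅) (hy : y ∈ polyhedron a b e ∅) : c x ≤ c y := by
  obtain ⟨m, hm⟩ := hc
  by_contra! hlt
  set θ := (c x - m + 1) / (c x - c y) with hθ
  have hz : x + θ • (y - x) ∈ polyhedron a b e ∅ :=
    ⟨fun i hi => by simp [hx.1 i hi, hy.1 i hi], by simp⟩
  have hcz : c (x + θ • (y - x)) = m - 1 := by
    have : c x - c y ≠ 0 := (sub_pos.2 hlt).ne'
    simp only [map_add, map_smul, map_sub, smul_eq_mul, hθ]
    field_simp
    ring
  linarith [hm ⟨_, hz, hcz⟩]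

theorem exists_mem_polyhedron_insert_eq {j : ι} {x y : E} (hx : x ∈ polyhedron a b e s)
    (hy : y ∈ polyhedron a b e s) (hxj : a j x < b j) (hyj : b j ≤ a j y) (hxy : c x ≤ c y) :
    ∃ z ∈ polyhedron a b (insert j e) s, c z ≤ c y := by
  have hpos : 0 < a j y - a j x := by linarith
  set θ := (b j - a j x) / (a j y - a j x) with hθ
  have hθ0 : 0 ≤ θ := div_nonneg (by linarith) hpos.le
  have hθ1 : θ ≤ 1 := (div_le_one hpos).2 (by linarith)
  have hval : ∀ g : Module.Dual 𝕜 E, g (x + θ • (y - x)) = (1 - θ) * g x + θ * g y := fun g => by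
    simp only [map_add, map_smul, map_sub, smul_eq_mul]
    ring
  refine ⟨x + θ • (y - x), ⟨?_, fun i hi => ?_⟩, ?_⟩
  · rintro i (rfl | hi)
    · rw [hval, hθ]
      field_simp
      ring
    · rw [hval, hx.1 i hi, hy.1 i hi]
      ring
  · rw [hval]
    nlinarith [mul_nonneg hθ0 (sub_nonneg.2 (hy.2 i hi)),
      mul_nonneg (sub_nonneg.2 hθ1) (sub_nonneg.2 (hx.2 i hi))]
  · rw [hval]
    nlinarith

theorem exists_isMinOn_polyhedron (hs : s.Finite) (hne : (polyhedron a b e s).Nonempty)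
    (hc : BddBelow (c '' polyhedron a b e s)) :
    ∃ x ∈ polyhedron a b e s, IsMinOn c (polyhedron a b e s) x := by
  induction s, hs using Set.Finite.induction_on generalizing e with
  | empty =>
    obtain ⟨x, hx⟩ := hne
    exact ⟨x, hx, fun y hy => le_of_bddBelow_image_polyhedron_empty hc hx hy⟩
  | @insert j s _ _ ih =>
    by_cases hmin : ∃ x ∈ polyhedron a b e (insert j s), IsMinOn c (polyhedron a b e s) x
    · obtain ⟨x, hx, hmin⟩ := hmin
      exact ⟨x, hx, hmin.on_subset (polyhedron_insert_subset j)⟩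
    -- Without the inequality `j`, some point violating it does at least as well as `y`;
    -- the segment from there to `y` meets the hyperplane `a j = b j`.
    have hface : ∀ y ∈ polyhedron a b e (insert j s),
        ∃ z ∈ polyhedron a b (insert j e) s, c z ≤ c y := by
      intro y hy
      have hy' := polyhedron_insert_subset j hy
      have hviol : ∃ x ∈ polyhedron a b e s, a j x < b j ∧ c x ≤ c y := by
        by_contra! hviol
        obtain ⟨m, hm⟩ := hc
        have hbd : BddBelow (c '' polyhedron a b e s) := by
          refine ⟨m, Set.forall_mem_image.2 fun x hx => ?_⟩
          by_cases hxj : a j x < b j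
          · exact (hm ⟨y, hy, rfl⟩).trans (hviol x hx hxj).le
          · exact hm ⟨x, ⟨hx.1, Set.forall_mem_insert.2 ⟨not_lt.1 hxj, hx.2⟩⟩, rfl⟩
        obtain ⟨x, hx, hxmin⟩ := ih ⟨y, hy'⟩ hbd
        refine hmin ⟨x, ⟨hx.1, Set.forall_mem_insert.2 ⟨?_, hx.2⟩⟩, hxmin⟩
        by_contra! hxj
        exact (hviol x hx hxj).not_ge (hxmin hy')
      obtain ⟨x, hx, hxj, hxy⟩ := hviol
      exact exists_mem_polyhedron_insert_eq hx hy' hxj (hy.2 j (Set.mem_insert j s)) hxy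
    obtain ⟨y, hy⟩ := hne
    obtain ⟨z, hz, -⟩ := hface y hy
    obtain ⟨x, hx, hxmin⟩ :=
      ih ⟨z, hz⟩ (hc.mono (Set.image_mono (polyhedron_insert_eq_subset j)))
    refine ⟨x, polyhedron_insert_eq_subset j hx, fun y hy => ?_⟩
    obtain ⟨z, hz, hzy⟩ := hface y hy
    exact (hxmin hz).trans hzy

end LinearProgram

theorem sum_prod_mul_apply {ι R : Type*} [Fintype ι] [DecidableEq ι] [CommSemiring R]
    {κ : ι → Type*} [∀ l, Fintype (κ l)] {w : ∀ l, κ l → R} {i : ι}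
    (hw : ∀ l ≠ i, ∑ j, w l j = 1) (g : κ i → R) :
    ∑ s : ∀ l, κ l, (∏ l, w l (s l)) * g (s i) = ∑ j, w i j * g j := by
  set v : ∀ l, κ l → R := Function.update (fun _ _ => 1) i g
  have hi : v i = g := Function.update_self ..
  have hne : ∀ l ≠ i, v l = fun _ => 1 := fun l hl => Function.update_of_ne hl ..
  have hg : ∀ s : ∀ l, κ l, g (s i) = ∏ l, v l (s l) := fun s => by
    rw [Fintype.prod_eq_single i fun l hl => by rw [hne l hl], hi]
  simp only [hg, ← Finset.prod_mul_distrib]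
  rw [← Fintype.piFinset_univ, ← Finset.prod_univ_sum _ fun l j => w l j * v l j,
    Fintype.prod_eq_single i fun l hl => by simp only [hne l hl, mul_one, hw l hl], hi]

theorem eventually_sum_sub_le {ι α : Type*} {l : Filter α} {A : Finset ι} {v : ι → α → ℝ}
    {ρ : ι → ℝ} (hv : ∀ i ∈ A, IsBoundedUnder (· ≥ ·) l (v i))
    (hρ : ∀ i ∈ A, ρ i ≤ liminf (v i) l) {ε : ℝ} (hε : 0 < ε) :
    ∀ᶠ x in l, ∑ i ∈ A, ρ i - ε ≤ ∑ i ∈ A, v i x := by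
  have hδ : 0 < ε / (A.card + 1) := by positivity
  have hcard : A.card * (ε / (A.card + 1)) ≤ ε := by
    rw [mul_div_assoc', div_le_iff₀ (by positivity)]
    linarith
  have hall : ∀ᶠ x in l, ∀ i ∈ A, ρ i - ε / (A.card + 1) < v i x :=
    (eventually_all_finset A).2 fun i hi =>
      eventually_lt_of_lt_liminf ((sub_lt_self _ hδ).trans_le (hρ i hi)) (hv i hi)
  filter_upwards [hall] with x hx
  have hsum := Finset.sum_le_sum fun i hi => (hx i hi).le
  rw [Finset.sum_sub_distrib, Finset.sum_const, nsmul_eq_mul] at hsum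
  linarith

namespace MonotoneBandit

variable {n : ℕ} {K : Fin n → ℕ}

/-! ### The balanced program -/

section

variable (B : MonotoneBandit n K) {D : DualSolution K} {i : Fin n}
  {k : Fin (K i)} {lam h : ℝ} {p : Fin (K i) → ℝ} {t : ℕ}

/-- The expected change `ΔP` of a potential at an escape, as a linear function of the potential. -/
noncomputable def escapeGain (i : Fin n) (k : Fin (K i)) : Module.Dual ℝ (Fin (K i) → ℝ) :=
  ∑ j with j ≠ k, B.q i k j •
    (LinearMap.proj (R := ℝ) (φ := fun _ : Fin (K i) => ℝ) j - LinearMap.proj k)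

theorem escapeGain_apply (p : Fin (K i) → ℝ) :
    B.escapeGain i k p = ∑ j with j ≠ k, B.q i k j * (p j - p k) := by
  simp [escapeGain]

theorem deltaP_eq_escapeGain : B.deltaP D i k = B.escapeGain i k (D.p i) :=
  (B.escapeGain_apply _).symm

theorem escapeGain_single_of_ne {j : Fin (K i)} (hjk : j ≠ k) :
    B.escapeGain i j (Pi.single k 1) = B.q i j k := by
  rw [escapeGain_apply, Finset.sum_eq_single k]
  · simp [hjk]
  · rintro l - hlk
    simp [hlk, hjk]
  · simp [hjk.symm]

/-- The slack of the constraint of (Balance) for `i`, `k`, `t`, at `λ = lam`, `h_i = h` and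
`p^i = p`. -/
noncomputable def slack (i : Fin n) (k : Fin (K i)) (t : ℕ) (lam h : ℝ) (p : Fin (K i) → ℝ) : ℝ :=
  B.L i k * (lam + h) + (t - 1) * h - (B.r i k + B.f i k t * B.escapeGain i k p)

/-- The constraints of (Balance) for arm `i`, at `λ = lam`, `h_i = h` and `p^i = p`. -/
def ArmFeasible (i : Fin n) (lam h : ℝ) (p : Fin (K i) → ℝ) : Prop :=
  ∀ k, ∀ t ∈ B.W i k, 0 ≤ B.slack i k t lam h p

theorem tight_iff_slack_eq_zero : B.Tight D i k t ↔ B.slack i k t D.lam (D.h i) (D.p i) = 0 := by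
  rw [Tight, slack, deltaP_eq_escapeGain, sub_eq_zero]

theorem balanceFeasible_iff : B.BalanceFeasible D ↔
    (∀ i, B.ArmFeasible i D.lam (D.h i) (D.p i)) ∧ B.M * D.lam = ∑ i, D.h i ∧ ∀ i, 0 ≤ D.h i := by
  have hmain : (∀ i, B.ArmFeasible i D.lam (D.h i) (D.p i)) ↔ ∀ i k, ∀ t ∈ B.W i k,
      B.r i k + B.f i k t * B.deltaP D i k ≤ B.L i k * (D.lam + D.h i) + (t - 1) * D.h i := by
    simp only [ArmFeasible, slack, deltaP_eq_escapeGain, sub_nonneg]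
  rw [hmain]
  refine ⟨fun hD => ⟨hD.main, hD.balance, hD.h_nonneg⟩, fun ⟨h1, h2, h3⟩ => ⟨h1, h2, ?_, h3⟩⟩
  have hM : (0 : ℝ) < B.M := by exact_mod_cast B.M_pos
  exact nonneg_of_mul_nonneg_right (h2 ▸ Finset.sum_nonneg fun i _ => h3 i) hM

variable {B}

theorem BalanceFeasible.armFeasible (hD : B.BalanceFeasible D) (i : Fin n) :
    B.ArmFeasible i D.lam (D.h i) (D.p i) :=
  (B.balanceFeasible_iff.1 hD).1 i

theorem BalanceFeasible.balanceObj_eq (hD : B.BalanceFeasible D) :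
    B.balanceObj D = 2 * (B.M * D.lam) := by
  rw [balanceObj, ← hD.balance, two_mul]

theorem ArmFeasible.sub_add (hp : B.ArmFeasible i lam h p) {μ : ℝ} (hμ : 0 ≤ μ) :
    B.ArmFeasible i (lam - μ) (h + μ) p := by
  intro k t ht
  have h1 : (1 : ℝ) ≤ t := by exact_mod_cast B.W_pos i k t ht
  have h2 : B.slack i k t (lam - μ) (h + μ) p = B.slack i k t lam h p + (t - 1) * μ := by
    simp only [slack]
    ring
  rw [h2]
  exact add_nonneg (hp k t ht) (mul_nonneg (sub_nonneg.2 h1) hμ)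

variable (B)

theorem f_le_f (i : Fin n) (k : Fin (K i)) {s t : ℕ} (hs : 1 ≤ s) (hst : s ≤ t) :
    B.f i k s ≤ B.f i k t := by
  induction t, hst using Nat.le_induction with
  | base => exact le_rfl
  | succ t h ih => exact ih.trans (B.f_mono i k t (hs.trans h))

/-- The point `(1 - θ) * t₁ + θ * t₂` lies strictly before `t` only after the last breakpoint. -/
theorem exists_f_eq_interp (i : Fin n) (k : Fin (K i)) (ht : 1 ≤ t) :
    ∃ t₁ ∈ B.W i k, ∃ t₂ ∈ B.W i k, ∃ θ ∈ Set.Icc (0 : ℝ) 1,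
      (1 - θ) * t₁ + θ * t₂ ≤ t ∧ B.f i k t = (1 - θ) * B.f i k t₁ + θ * B.f i k t₂ := by
  obtain ⟨t₁, h₁, hmax⟩ := {s ∈ B.W i k | s ≤ t}.exists_max_image id
    ⟨1, Finset.mem_filter.2 ⟨B.one_mem_W i k, ht⟩⟩
  obtain ⟨h₁W, h₁t⟩ := Finset.mem_filter.1 h₁
  have hmax' : ∀ s ∈ B.W i k, s ≤ t → s ≤ t₁ := fun s hs hst =>
    hmax s (Finset.mem_filter.2 ⟨hs, hst⟩)
  by_cases hlast : ∀ s ∈ B.W i k, s ≤ t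
  · refine ⟨t₁, h₁W, t₁, h₁W, 0, by simp, by simpa using h₁t, ?_⟩
    simp [B.f_tail i k t₁ h₁W (fun s hs => hmax' s hs (hlast s hs)) t h₁t]
  push Not at hlast
  obtain ⟨s, hsW, hs⟩ := hlast
  obtain ⟨t₂, h₂, hmin⟩ := {s ∈ B.W i k | t < s}.exists_min_image id
    ⟨s, Finset.mem_filter.2 ⟨hsW, hs⟩⟩
  obtain ⟨h₂W, h₂t⟩ := Finset.mem_filter.1 h₂
  have hconsec : ∀ s ∈ B.W i k, ¬ (t₁ < s ∧ s < t₂) := fun s hs ⟨hs₁, hs₂⟩ => by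
    rcases le_or_gt s t with hst | hst
    · exact (hmax' s hs hst).not_gt hs₁
    · exact (hmin s (Finset.mem_filter.2 ⟨hs, hst⟩)).not_gt hs₂
  have h12 : (t₁ : ℝ) < t₂ := by exact_mod_cast h₁t.trans_lt h₂t
  have h1t : (t₁ : ℝ) ≤ t := by exact_mod_cast h₁t
  have ht2 : (t : ℝ) ≤ t₂ := by exact_mod_cast h₂t.le
  have hne : (t₂ : ℝ) - t₁ ≠ 0 := (sub_pos.2 h12).ne'
  refine ⟨t₁, h₁W, t₂, h₂W, (t - t₁) / (t₂ - t₁), ⟨?_, ?_⟩, le_of_eq ?_, ?_⟩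
  · exact div_nonneg (by linarith) (by linarith)
  · exact (div_le_one (by linarith)).2 (by linarith)
  · field_simp
    ring
  · rw [B.f_interp i k t₁ h₁W t₂ h₂W (h₁t.trans_lt h₂t) hconsec t h₁t h₂t.le]
    field_simp
    ring

variable {B}

theorem ArmFeasible.slack_nonneg (hp : B.ArmFeasible i lam h p) (hh : 0 ≤ h) (k : Fin (K i))
    (ht : 1 ≤ t) : 0 ≤ B.slack i k t lam h p := by
  obtain ⟨t₁, h₁, t₂, h₂, θ, ⟨hθ0, hθ1⟩, hle, hf⟩ := B.exists_f_eq_interp i k ht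
  have hslack : B.slack i k t lam h p = (1 - θ) * B.slack i k t₁ lam h p +
      θ * B.slack i k t₂ lam h p + (t - ((1 - θ) * t₁ + θ * t₂)) * h := by
    simp only [slack, hf]
    ring
  rw [hslack]
  have h3 := mul_nonneg (sub_nonneg.2 hle) hh
  have h4 := mul_nonneg (sub_nonneg.2 hθ1) (hp k t₁ h₁)
  linarith [mul_nonneg hθ0 (hp k t₂ h₂)]

theorem BalanceFeasible.reward_add_le (hD : B.BalanceFeasible D) (i : Fin n) (k : Fin (K i))
    (ht : 1 ≤ t) : B.r i k + B.f i k t * B.deltaP D i k ≤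
      B.L i k * (D.lam + D.h i) + (t - 1) * D.h i := by
  rw [deltaP_eq_escapeGain]
  exact sub_nonneg.1 ((hD.armFeasible i).slack_nonneg (hD.h_nonneg i) k ht)

variable (B)

/-! ### Optimal solutions -/

/-- The variables `h` and `p` as a dual solution, with `λ` determined by the balance equation. This
leaves a linear program with inequality constraints only. -/
noncomputable def balancedDual (x : (Fin n → ℝ) × ∀ i, Fin (K i) → ℝ) : DualSolution K :=
  ⟨(∑ i, x.1 i) / B.M, x.1, x.2⟩

theorem mul_lam_balancedDual (x : (Fin n → ℝ) × ∀ i, Fin (K i) → ℝ) :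
    B.M * (B.balancedDual x).lam = ∑ i, (B.balancedDual x).h i :=
  mul_div_cancel₀ _ (by exact_mod_cast (Nat.one_le_iff_ne_zero.1 B.M_pos))

variable {B} in
theorem BalanceFeasible.balancedDual_eq (hD : B.BalanceFeasible D) :
    B.balancedDual (D.h, D.p) = D := by
  have hM : (B.M : ℝ) ≠ 0 := by exact_mod_cast (Nat.one_le_iff_ne_zero.1 B.M_pos)
  obtain ⟨lam, h, p⟩ := D
  simp only [balancedDual, DualSolution.mk.injEq, and_true]
  exact (eq_div_of_mul_eq hM ((mul_comm _ _).trans hD.balance)).symm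

/-- The left-hand sides of the inequalities of (Balance) in the variables `h` and `p`. -/
noncomputable def balanceFunctional :
    (Σ i, Σ k : Fin (K i), B.W i k) ⊕ Fin n → Module.Dual ℝ ((Fin n → ℝ) × ∀ i, Fin (K i) → ℝ)
  | .inl ⟨i, k, t⟩ =>
      (B.L i k : ℝ) • ((B.M : ℝ)⁻¹ • ∑ l, LinearMap.proj l + LinearMap.proj i) ∘ₗ
          LinearMap.fst ℝ _ _ +
        ((t : ℝ) - 1) • LinearMap.proj i ∘ₗ LinearMap.fst ℝ _ _ -
        B.f i k t • B.escapeGain i k ∘ₗ LinearMap.proj i ∘ₗ LinearMap.snd ℝ _ _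
  | .inr i => LinearMap.proj i ∘ₗ LinearMap.fst ℝ _ _

theorem mem_polyhedron_balanceFunctional (x : (Fin n → ℝ) × ∀ i, Fin (K i) → ℝ) :
    x ∈ polyhedron B.balanceFunctional (Sum.elim (fun z => B.r z.1 z.2.1) 0) ∅ Set.univ ↔
      B.BalanceFeasible (B.balancedDual x) := by
  have hfun : ∀ i k t, B.r i k ≤ B.balanceFunctional (.inl ⟨i, k, t⟩) x ↔
      0 ≤ B.slack i k t (B.balancedDual x).lam ((B.balancedDual x).h i)
        ((B.balancedDual x).p i) := fun i k t => by
    simp only [balanceFunctional, slack, balancedDual, LinearMap.sub_apply, LinearMap.add_apply,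
      LinearMap.smul_apply, LinearMap.comp_apply, LinearMap.coe_sum, Finset.sum_apply,
      LinearMap.proj_apply, LinearMap.fst_apply, LinearMap.snd_apply, smul_eq_mul]
    rw [← sub_nonneg, inv_mul_eq_div]
    ring_nf
  simp only [polyhedron, Set.mem_ofPred_eq, Set.mem_empty_iff_false, IsEmpty.forall_iff,
    implies_true, Set.mem_univ, true_imp_iff, true_and, Sum.forall, Sigma.forall, Sum.elim_inl,
    hfun, Subtype.forall, balanceFeasible_iff, mul_lam_balancedDual]
  rfl

theorem exists_balanceFeasible : ∃ D : DualSolution K, B.BalanceFeasible D := by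
  set R : ℝ := ∑ i, ∑ k, B.r i k
  have hle : ∀ i k, B.r i k ≤ R := fun i k =>
    (Finset.single_le_sum (fun k _ => B.r_nonneg i k) (Finset.mem_univ k)).trans
      (Finset.single_le_sum (f := fun i => ∑ k, B.r i k)
        (fun i _ => Finset.sum_nonneg fun k _ => B.r_nonneg i k) (Finset.mem_univ i))
  have hR0 : 0 ≤ R := Finset.sum_nonneg fun i _ => Finset.sum_nonneg fun k _ => B.r_nonneg i k
  have hlam : 0 ≤ (∑ _i : Fin n, R) / B.M :=
    div_nonneg (Finset.sum_nonneg fun _ _ => hR0) (Nat.cast_nonneg _)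
  refine ⟨B.balancedDual (fun _ => R, 0), B.balanceFeasible_iff.2
    ⟨fun i k t ht => ?_, B.mul_lam_balancedDual _, fun _ => hR0⟩⟩
  have h1 : (1 : ℝ) ≤ B.L i k := by exact_mod_cast B.L_pos i k
  have h2 : (1 : ℝ) ≤ t := by exact_mod_cast B.W_pos i k t ht
  simp only [slack, balancedDual, Pi.zero_apply, map_zero, mul_zero, add_zero]
  nlinarith [hle i k, mul_nonneg (sub_nonneg.2 h2) hR0,
    mul_nonneg (sub_nonneg.2 h1) (add_nonneg hlam hR0)]

theorem exists_balanceOptimal : ∃ D : DualSolution K, B.BalanceOptimal D := by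
  set P := polyhedron B.balanceFunctional (Sum.elim (fun z => B.r z.1 z.2.1) 0) ∅ Set.univ
  let c : Module.Dual ℝ ((Fin n → ℝ) × ∀ i, Fin (K i) → ℝ) :=
    (2 : ℝ) • (∑ i, LinearMap.proj i) ∘ₗ LinearMap.fst ℝ _ _
  have hc : ∀ x ∈ P, c x = B.balanceObj (B.balancedDual x) := fun x hx => by
    rw [((B.mem_polyhedron_balanceFunctional x).1 hx).balanceObj_eq, mul_lam_balancedDual]
    simp [c, balancedDual]
  have hmem : ∀ {D}, B.BalanceFeasible D → (D.h, D.p) ∈ P := fun hD =>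
    (B.mem_polyhedron_balanceFunctional _).2 (hD.balancedDual_eq.symm ▸ hD)
  have hbdd : BddBelow (c '' P) := by
    refine ⟨0, Set.forall_mem_image.2 fun x hx => ?_⟩
    have hD := (B.mem_polyhedron_balanceFunctional x).1 hx
    rw [hc x hx, hD.balanceObj_eq]
    exact mul_nonneg zero_le_two (mul_nonneg (Nat.cast_nonneg _) hD.lam_nonneg)
  obtain ⟨D₀, hD₀⟩ := B.exists_balanceFeasible
  obtain ⟨x, hx, hmin⟩ := exists_isMinOn_polyhedron Set.finite_univ ⟨_, hmem hD₀⟩ hbdd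
  refine ⟨B.balancedDual x, (B.mem_polyhedron_balanceFunctional x).1 hx, fun D' hD' => ?_⟩
  have h1 : c x ≤ c (D'.h, D'.p) := hmin (hmem hD')
  rwa [hc x hx, hc _ (hmem hD'), hD'.balancedDual_eq] at h1

end

/-! ### Playing one arm over and over -/

section

variable (B : MonotoneBandit n K) {D : DualSolution K} {i : Fin n}
  {k : Fin (K i)} {lam h : ℝ} {p : Fin (K i) → ℝ} {t : ℕ}

theorem sum_trans_mul (i : Fin n) (k : Fin (K i)) (t : ℕ) (v : Fin (K i) → ℝ) :
    ∑ j, B.trans i k t j * v j = v k + B.f i k t * B.escapeGain i k v := by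
  have hsplit : ∑ j, B.trans i k t j * v j = B.trans i k t k * v k +
      ∑ j with j ≠ k, B.trans i k t j * v j := by
    rw [← Finset.sum_filter_add_sum_filter_not Finset.univ (fun j => j = k)]
    simp [Finset.filter_eq']
  have hescape : ∑ j with j ≠ k, B.trans i k t j * v j =
      ∑ j with j ≠ k, B.q i k j * B.f i k t * v j :=
    Finset.sum_congr rfl fun j hj => by rw [trans, if_neg (Finset.mem_filter.1 hj).2]
  rw [hsplit, hescape, trans, if_pos rfl, escapeGain_apply, Finset.mul_sum, sub_mul, one_mul,
    Finset.sum_mul, sub_add_eq_add_sub, add_sub_assoc, ← Finset.sum_sub_distrib]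
  congr 1
  exact Finset.sum_congr rfl fun j _ => by ring

theorem sum_trans (i : Fin n) (k : Fin (K i)) (t : ℕ) : ∑ j, B.trans i k t j = 1 := by
  simpa [escapeGain_apply] using B.sum_trans_mul i k t fun _ => 1

theorem trans_nonneg (i : Fin n) (k : Fin (K i)) (ht : 1 ≤ t) (j : Fin (K i)) :
    0 ≤ B.trans i k t j := by
  unfold trans
  split_ifs
  · rw [← Finset.sum_mul, sub_nonneg]
    exact mul_le_one₀ (B.q_sum_le i k) (B.f_nonneg i k t ht) (B.f_le_one i k t ht)
  · exact mul_nonneg (B.q_nonneg i k j) (B.f_nonneg i k t ht)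

theorem repeatValue_nonneg (i : Fin n) (T : ℕ) (k : Fin (K i)) : 0 ≤ B.repeatValue i T k := by
  induction T using Nat.strong_induction_on generalizing k with
  | _ T ih =>
    cases T with
    | zero => simp [repeatValue]
    | succ T =>
      have := B.L_pos i k
      rw [repeatValue]
      exact add_nonneg (B.r_nonneg i k) (Finset.sum_nonneg fun j _ =>
        mul_nonneg (B.trans_nonneg i k le_rfl j) (ih _ (by lia) j))

theorem repeatValue_le (i : Fin n) (T : ℕ) (k : Fin (K i)) :
    B.repeatValue i T k ≤ T * ∑ j, B.r i j := by
  induction T using Nat.strong_induction_on generalizing k with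
  | _ T ih =>
    cases T with
    | zero => simp [repeatValue]
    | succ T =>
      have hL := B.L_pos i k
      have hR : 0 ≤ ∑ j, B.r i j := Finset.sum_nonneg fun j _ => B.r_nonneg i j
      have hrec : ∑ j, B.trans i k 1 j * B.repeatValue i (T + 1 - B.L i k) j ≤
          ∑ j, B.trans i k 1 j * (T * ∑ j, B.r i j) := by
        refine Finset.sum_le_sum fun j _ =>
          mul_le_mul_of_nonneg_left ?_ (B.trans_nonneg i k le_rfl j)
        refine (ih _ (by lia) j).trans (mul_le_mul_of_nonneg_right ?_ hR)
        exact_mod_cast (show T + 1 - B.L i k ≤ T by lia)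
      rw [← Finset.sum_mul, B.sum_trans, one_mul] at hrec
      have hr := Finset.single_le_sum (fun j _ => B.r_nonneg i j) (Finset.mem_univ k)
      rw [repeatValue]
      push_cast
      linarith

theorem isBoundedUnder_repeatValue (i : Fin n) (k : Fin (K i)) :
    IsBoundedUnder (· ≤ ·) atTop fun T : ℕ => B.repeatValue i T k / (T : ℝ) := by
  refine isBoundedUnder_of ⟨∑ j, B.r i j, fun T => ?_⟩
  exact div_le_of_le_mul₀ (Nat.cast_nonneg _) (Finset.sum_nonneg fun j _ => B.r_nonneg i j)
    ((B.repeatValue_le i T k).trans_eq (mul_comm _ _))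

theorem mul_le_repeatValue (hf : B.f i k 1 = 0) {ρ : ℝ} (hρ : 0 ≤ ρ)
    (hr : B.L i k * ρ ≤ B.r i k) (T : ℕ) : T * ρ ≤ B.repeatValue i T k := by
  induction T using Nat.strong_induction_on with
  | _ T ih =>
    cases T with
    | zero => simp [repeatValue]
    | succ T =>
      have hL := B.L_pos i k
      have hT : ((T + 1 : ℕ) : ℝ) ≤ B.L i k + (T + 1 - B.L i k : ℕ) := by
        exact_mod_cast (show T + 1 ≤ B.L i k + (T + 1 - B.L i k) by lia)
      rw [repeatValue, B.sum_trans_mul, hf, zero_mul, add_zero]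
      nlinarith [ih (T + 1 - B.L i k) (by lia)]

theorem lucrative_of_f_eq_zero (hρ : 0 ≤ D.lam + D.h i) (hf : B.f i k 1 = 0)
    (hr : B.L i k * (D.lam + D.h i) ≤ B.r i k) : B.Lucrative D i k := by
  refine le_liminf_of_le (B.isBoundedUnder_repeatValue i k).isCoboundedUnder_ge ?_
  filter_upwards [eventually_gt_atTop 0] with T hT
  rw [le_div_iff₀ (by exact_mod_cast hT), mul_comm]
  exact B.mul_le_repeatValue hf hρ hr T

/-! ### Complementary slackness -/

/-- All constraints of (Balance) for arm `i` and state `k` hold strictly, at `λ = lam`, `h_i = h`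
and `p^i = p`. -/
def StrictAt (i : Fin n) (lam h : ℝ) (p : Fin (K i) → ℝ) (k : Fin (K i)) : Prop :=
  ∀ t ∈ B.W i k, 0 < B.slack i k t lam h p

variable {B}

theorem mem_U₁ : i ∈ B.U₁ D ↔ ∃ k, B.Lucrative D i k := by
  simp [U₁]

theorem mem_U₂ : i ∈ B.U₂ D ↔ i ∉ B.U₁ D ∧ 0 < D.h i := by
  simp [U₂]

theorem BalanceFeasible.slack_pos_of_f_eq_zero (hD : B.BalanceFeasible D) (hi : i ∉ B.U₁ D)
    (ht : 1 ≤ t) (hf : B.f i k t = 0) (p : Fin (K i) → ℝ) :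
    0 < B.slack i k t D.lam (D.h i) p := by
  have hρ : 0 ≤ D.lam + D.h i := add_nonneg hD.lam_nonneg (hD.h_nonneg i)
  have hf1 : B.f i k 1 = 0 :=
    le_antisymm ((B.f_le_f i k le_rfl ht).trans hf.le) (B.f_nonneg i k 1 le_rfl)
  have hr : B.r i k < B.L i k * (D.lam + D.h i) := by
    by_contra! hr
    exact hi (mem_U₁.2 ⟨k, B.lucrative_of_f_eq_zero hρ hf1 hr⟩)
  have ht' : (0 : ℝ) ≤ (t - 1) * D.h i :=
    mul_nonneg (sub_nonneg.2 (by exact_mod_cast ht)) (hD.h_nonneg i)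
  rw [slack, hf]
  linarith

theorem slack_sub_smul_single_of_ne {j : Fin (K i)} (hjk : j ≠ k) (ε : ℝ) :
    B.slack i j t lam h (p - ε • Pi.single k 1) =
      B.slack i j t lam h p + ε * (B.f i j t * B.q i j k) := by
  simp only [slack, map_sub, map_smul, B.escapeGain_single_of_ne hjk, smul_eq_mul]
  ring

theorem StrictAt.exists_sub_smul_single (hk : B.StrictAt i lam h p k) :
    ∃ ε > (0 : ℝ), B.StrictAt i lam h (p - ε • Pi.single k 1) k := by
  have hev : ∀ᶠ ε in nhdsWithin (0 : ℝ) (Set.Ioi 0), ∀ t ∈ B.W i k,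
      0 < B.slack i k t lam h (p - ε • Pi.single k 1) := by
    refine (eventually_all_finset _).2 fun t ht => Eventually.filter_mono nhdsWithin_le_nhds ?_
    refine continuousAt_const.eventually_lt ?_ (by simpa using hk t ht)
    simp only [slack, map_sub, map_smul]
    fun_prop
  obtain ⟨ε, hε, hε0⟩ := (hev.and self_mem_nhdsWithin).exists
  exact ⟨ε, hε0, hε⟩

/-- Lowering the potential at the head of an edge relaxes the constraints at its tail. -/
theorem BalanceFeasible.exists_strictAt_of_edge (hD : B.BalanceFeasible D) (hi : i ∉ B.U₁ D)
    {j : Fin (K i)} (hjk : 0 < B.q i j k)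
    (hk : ∃ p, B.ArmFeasible i D.lam (D.h i) p ∧ B.StrictAt i D.lam (D.h i) p k) :
    ∃ p, B.ArmFeasible i D.lam (D.h i) p ∧ B.StrictAt i D.lam (D.h i) p j := by
  obtain ⟨p, hp, hs⟩ := hk
  rcases eq_or_ne j k with rfl | hne
  · exact ⟨p, hp, hs⟩
  obtain ⟨ε, hε0, hε⟩ := hs.exists_sub_smul_single
  refine ⟨p - ε • Pi.single k 1, fun l t ht => ?_, fun t ht => ?_⟩
  · rcases eq_or_ne l k with rfl | hl
    · exact (hε t ht).le
    · rw [slack_sub_smul_single_of_ne hl]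
      exact add_nonneg (hp l t ht) (mul_nonneg hε0.le
        (mul_nonneg (B.f_nonneg i l t (B.W_pos i l t ht)) (B.q_nonneg i l k)))
  · have ht1 := B.W_pos i j t ht
    rcases (B.f_nonneg i j t ht1).eq_or_lt with h0 | h0
    · exact hD.slack_pos_of_f_eq_zero hi ht1 h0.symm _
    · rw [slack_sub_smul_single_of_ne hne]
      exact add_pos_of_nonneg_of_pos (hp j t ht) (mul_pos hε0 (mul_pos h0 hjk))

theorem mul_slack_average (P : Fin (K i) → Fin (K i) → ℝ) :
    K i * B.slack i k t lam h ((K i : ℝ)⁻¹ • ∑ j, P j) = ∑ j, B.slack i k t lam h (P j) := by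
  have hK : (K i : ℝ) ≠ 0 := by exact_mod_cast (Nat.one_le_iff_ne_zero.1 (B.K_pos i))
  simp only [slack, map_smul, map_sum, smul_eq_mul, Finset.sum_sub_distrib,
    Finset.sum_add_distrib, Finset.sum_const, Finset.card_univ, Fintype.card_fin, nsmul_eq_mul,
    ← Finset.mul_sum]
  field_simp

theorem exists_forall_strictAt
    (hstrict : ∀ j, ∃ p, B.ArmFeasible i lam h p ∧ B.StrictAt i lam h p j) :
    ∃ p, ∀ j, B.StrictAt i lam h p j := by
  choose P hP hS using hstrict
  refine ⟨(K i : ℝ)⁻¹ • ∑ j, P j, fun j t ht => ?_⟩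
  refine pos_of_mul_pos_right (a := (K i : ℝ)) ?_ (Nat.cast_nonneg _)
  rw [mul_slack_average]
  exact Finset.sum_pos' (fun l _ => hP l j t ht) ⟨j, Finset.mem_univ j, hS j t ht⟩

theorem BalanceFeasible.exists_forall_strictAt (hD : B.BalanceFeasible D) (hi : i ∉ B.U₁ D)
    (hk : B.StrictAt i D.lam (D.h i) (D.p i) k) :
    ∃ p, ∀ j, B.StrictAt i D.lam (D.h i) p j := by
  refine MonotoneBandit.exists_forall_strictAt fun j => ?_
  induction B.q_connected i j k using Relation.ReflTransGen.head_induction_on with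
  | refl => exact ⟨D.p i, hD.armFeasible i, hk⟩
  | head hedge _ ih => exact hD.exists_strictAt_of_edge hi hedge ih

/-- Transfer of the slack of arm `i` to the other arms; `h_i` decreases by `(M + n - 1) μ` because
the balance equation has to be preserved. -/
theorem BalanceFeasible.exists_lam_eq_sub (hD : B.BalanceFeasible D) {μ : ℝ} (hμ : 0 ≤ μ)
    (hh : 0 ≤ D.h i - (B.M + n - 1) * μ)
    (hp : B.ArmFeasible i (D.lam - μ) (D.h i - (B.M + n - 1) * μ) p) :
    ∃ D', B.BalanceFeasible D' ∧ D'.lam = D.lam - μ := by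
  refine ⟨⟨D.lam - μ, Function.update (fun l => D.h l + μ) i (D.h i - (B.M + n - 1) * μ),
    Function.update D.p i p⟩, B.balanceFeasible_iff.2 ⟨fun l => ?_, ?_, fun l => ?_⟩, rfl⟩
  · rcases eq_or_ne l i with rfl | hl
    · simpa only [Function.update_self] using hp
    · simpa only [Function.update_of_ne hl] using (hD.armFeasible l).sub_add hμ
  · have hsum := Finset.add_sum_erase Finset.univ D.h (Finset.mem_univ i)
    dsimp only
    rw [← Finset.add_sum_erase _ _ (Finset.mem_univ i), Function.update_self,
      Finset.sum_congr rfl fun l hl => Function.update_of_ne (Finset.ne_of_mem_erase hl) _ _,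
      Finset.sum_add_distrib, Finset.sum_const, Finset.card_erase_of_mem (Finset.mem_univ i),
      Finset.card_univ, Fintype.card_fin, nsmul_eq_mul, Nat.cast_sub i.pos, Nat.cast_one]
    linarith [hD.balance]
  · rcases eq_or_ne l i with rfl | hl
    · simpa only [Function.update_self] using hh
    · simpa only [Function.update_of_ne hl] using add_nonneg (hD.h_nonneg l) hμ

theorem exists_pos_armFeasible_of_strictAt (hh : 0 < h) (hp : ∀ j, B.StrictAt i lam h p j)
    (C : ℝ) : ∃ μ > 0, 0 ≤ h - C * μ ∧ B.ArmFeasible i (lam - μ) (h - C * μ) p := by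
  have hev : ∀ᶠ μ in nhdsWithin (0 : ℝ) (Set.Ioi 0), 0 < h - C * μ ∧
      ∀ j, ∀ t ∈ B.W i j, 0 < B.slack i j t (lam - μ) (h - C * μ) p := by
    refine Eventually.filter_mono nhdsWithin_le_nhds (.and ?_ (eventually_all.2 fun j =>
      (eventually_all_finset _).2 fun t ht => ?_))
    · exact continuousAt_const.eventually_lt (by fun_prop) (by simpa using hh)
    · refine continuousAt_const.eventually_lt ?_ (by simpa using hp j t ht)
      unfold slack
      fun_prop
  obtain ⟨μ, ⟨hμh, hμ⟩, hμ0⟩ := (hev.and self_mem_nhdsWithin).exists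
  exact ⟨μ, hμ0, hμh.le, fun j t ht => (hμ j t ht).le⟩

theorem BalanceOptimal.exists_tight (hD : B.BalanceOptimal D) (hi : i ∈ B.U₂ D)
    (k : Fin (K i)) : ∃ t ∈ B.W i k, B.Tight D i k t := by
  obtain ⟨hi₁, hh⟩ := mem_U₂.1 hi
  by_contra! hslack
  have hk : B.StrictAt i D.lam (D.h i) (D.p i) k := fun t ht =>
    (hD.1.armFeasible i k t ht).lt_of_ne' (mt B.tight_iff_slack_eq_zero.2 (hslack t ht))
  obtain ⟨p, hp⟩ := hD.1.exists_forall_strictAt hi₁ hk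
  obtain ⟨μ, hμ, hhμ, hpμ⟩ := exists_pos_armFeasible_of_strictAt hh hp (B.M + n - 1)
  obtain ⟨D', hD', hlam⟩ := hD.1.exists_lam_eq_sub hμ.le hhμ hpμ
  have hle := hD.2 D' hD'
  have hM : (0 : ℝ) < B.M := by exact_mod_cast B.M_pos
  rw [hD.1.balanceObj_eq, hD'.balanceObj_eq, hlam] at hle
  nlinarith [mul_pos hM hμ]

theorem BalanceFeasible.slack_pos_of_good (hD : B.BalanceFeasible D) (hi : i ∈ B.U₂ D)
    (hg : B.Good D i k) (ht : 1 < t) : 0 < B.slack i k t D.lam (D.h i) (D.p i) := by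
  have h1 := (hD.armFeasible i) k 1 (B.one_mem_W i k)
  have h2 := mul_le_mul_of_nonpos_right (B.f_le_f i k le_rfl ht.le) hg.le
  have h3 : (0 : ℝ) < (t - 1) * D.h i :=
    mul_pos (sub_pos.2 (by exact_mod_cast ht)) (mem_U₂.1 hi).2
  rw [slack, ← deltaP_eq_escapeGain] at h1 ⊢
  norm_num at h1
  linarith

theorem BalanceOptimal.tight_one_of_good (hD : B.BalanceOptimal D) (hi : i ∈ B.U₂ D)
    (hg : B.Good D i k) : B.Tight D i k 1 := by
  obtain ⟨t, htW, ht⟩ := hD.exists_tight hi k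
  obtain rfl | hlt := (B.W_pos i k t htW).eq_or_lt
  · exact ht
  · exact absurd (B.tight_iff_slack_eq_zero.1 ht) (hD.1.slack_pos_of_good hi hg hlt).ne'

end

/-! ### Expectations over one step -/

section

variable (B : MonotoneBandit n K) {i : Fin n}

theorem armProb_nonneg (i : Fin n) {c : ArmStatus (K i)} (play : Prop) [Decidable play]
    (hc : 1 ≤ c.elapsed) (j : Fin (K i)) : 0 ≤ B.armProb i c play j := by
  unfold armProb
  split_ifs
  exacts [B.trans_nonneg i _ hc j, zero_le_one, le_rfl]

theorem sum_armProb (i : Fin n) (c : ArmStatus (K i)) (play : Prop) [Decidable play] :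
    ∑ j, B.armProb i c play j = 1 := by
  unfold armProb
  split_ifs
  · exact B.sum_trans i _ _
  · simp

theorem jointProb_nonneg {c : BanditConfig K} (hc : ∀ i, 1 ≤ (c i).elapsed)
    (a : Finset (Fin n)) (s : ∀ i, Fin (K i)) : 0 ≤ B.jointProb c a s :=
  Finset.prod_nonneg fun i _ => B.armProb_nonneg i _ (hc i) _

theorem sum_jointProb (c : BanditConfig K) (a : Finset (Fin n)) :
    ∑ s, B.jointProb c a s = 1 := by
  unfold jointProb
  rw [← Fintype.piFinset_univ, ← Finset.prod_univ_sum _ fun l j => B.armProb l (c l) (l ∈ a) j]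
  simp [sum_armProb]

/-- Expectation of `g` at the situation of arm `i` after the coming step. -/
noncomputable def armExp (i : Fin n) (c : ArmStatus (K i)) (play : Prop) [Decidable play]
    (g : ArmStatus (K i) → ℝ) : ℝ :=
  ∑ j, B.armProb i c play j * g (B.armNext i c play j)

/-- Reward of arm `i` in the coming step plus the expectation of `g` after it. The policies are
analysed by comparing this with the value of `g` before the step. -/
noncomputable def armStep (i : Fin n) (c : ArmStatus (K i)) (play : Prop) [Decidable play]
    (g : ArmStatus (K i) → ℝ) : ℝ :=
  (if play then B.r i c.state else 0) + B.armExp i c play g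

/-- Expectation of `F` at the joint situation after the coming step. -/
noncomputable def expNext (c : BanditConfig K) (a : Finset (Fin n)) (F : BanditConfig K → ℝ) : ℝ :=
  ∑ s, B.jointProb c a s * F (B.next c a s)

theorem expNext_const_add (c : BanditConfig K) (a : Finset (Fin n)) (C : ℝ)
    (F : BanditConfig K → ℝ) : B.expNext c a (fun c' => C + F c') = C + B.expNext c a F := by
  simp only [expNext, mul_add, Finset.sum_add_distrib, ← Finset.sum_mul, sum_jointProb, one_mul]

theorem expNext_add (c : BanditConfig K) (a : Finset (Fin n)) (F G : BanditConfig K → ℝ) :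
    B.expNext c a (fun c' => F c' + G c') = B.expNext c a F + B.expNext c a G := by
  simp only [expNext, mul_add, Finset.sum_add_distrib]

theorem expNext_sum (c : BanditConfig K) (a S : Finset (Fin n)) (g : ∀ i, ArmStatus (K i) → ℝ) :
    B.expNext c a (fun c' => ∑ i ∈ S, g i (c' i)) =
      ∑ i ∈ S, B.armExp i (c i) (i ∈ a) (g i) := by
  simp only [expNext, Finset.mul_sum]
  rw [Finset.sum_comm]
  exact Finset.sum_congr rfl fun i _ =>
    sum_prod_mul_apply (w := fun l => B.armProb l (c l) (l ∈ a)) (fun l _ => B.sum_armProb l _ _)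
      fun j => g i (B.armNext i (c i) (i ∈ a) j)

theorem sum_armStep (c : BanditConfig K) (a S : Finset (Fin n)) (g : ∀ i, ArmStatus (K i) → ℝ) :
    ∑ i ∈ S, B.armStep i (c i) (i ∈ a) (g i) =
      B.reward c (S ∩ a) + B.expNext c a fun c' => ∑ i ∈ S, g i (c' i) := by
  simp only [armStep, Finset.sum_add_distrib, expNext_sum, reward]
  rw [← Finset.sum_filter, Finset.filter_mem_eq_inter]

theorem sum_armStep_add_sum_armStep_le (c : BanditConfig K) (a : Finset (Fin n))
    {S S' : Finset (Fin n)} (hS : Disjoint S S') (g g' : ∀ i, ArmStatus (K i) → ℝ) :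
    ∑ i ∈ S, B.armStep i (c i) (i ∈ a) (g i) + ∑ i ∈ S', B.armStep i (c i) (i ∈ a) (g' i) ≤
      B.reward c a +
        B.expNext c a fun c' => ∑ i ∈ S, g i (c' i) + ∑ i ∈ S', g' i (c' i) := by
  have hdisj : Disjoint (S ∩ a) (S' ∩ a) :=
    hS.mono Finset.inter_subset_left Finset.inter_subset_left
  have hreward : B.reward c (S ∩ a) + B.reward c (S' ∩ a) ≤ B.reward c a := by
    unfold reward
    rw [← Finset.sum_union hdisj]
    exact Finset.sum_le_sum_of_subset_of_nonneg
      (Finset.union_subset Finset.inter_subset_right Finset.inter_subset_right)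
      fun i _ _ => B.r_nonneg i _
  rw [sum_armStep, sum_armStep, expNext_add]
  linarith

section ArmStep

variable {c : ArmStatus (K i)} {play : Prop} [Decidable play] {g : ArmStatus (K i) → ℝ}

theorem armStep_of_idle (hr : c.rem = 0) (hp : ¬ play) :
    B.armStep i c play g = g ⟨c.state, c.elapsed + 1, 0⟩ := by
  simp [armStep, armExp, armNext, occupied, hr, hp, ← Finset.sum_mul, sum_armProb]

variable {G : ℕ → ℝ}

theorem armExp_of_occupied_ne_zero (ho : B.occupied i c play ≠ 0)
    (hend : ∑ j, B.trans i c.state c.elapsed j * g ⟨j, 1, 0⟩ = G 0)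
    (hrun : ∀ m ≠ 0, g ⟨c.state, c.elapsed, m⟩ = G m) :
    B.armExp i c play g = G (B.occupied i c play - 1) := by
  rcases eq_or_ne (B.occupied i c play) 1 with h1 | h1
  · simp [armExp, armNext, armProb, h1, hend]
  · rw [← hrun _ (by lia)]
    simp [armExp, armNext, ho, h1, ← Finset.sum_mul, sum_armProb]

theorem armStep_of_play (hr : c.rem = 0) (hp : play)
    (hend : ∑ j, B.trans i c.state c.elapsed j * g ⟨j, 1, 0⟩ = G 0)
    (hrun : ∀ m ≠ 0, g ⟨c.state, c.elapsed, m⟩ = G m) :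
    B.armStep i c play g = B.r i c.state + G (B.L i c.state - 1) := by
  have ho : B.occupied i c play = B.L i c.state := by simp [occupied, hr, hp]
  have hL := B.L_pos i c.state
  rw [armStep, if_pos hp, B.armExp_of_occupied_ne_zero (by lia) hend hrun, ho]

theorem armStep_of_busy (hr : c.rem ≠ 0) (hp : ¬ play)
    (hend : ∑ j, B.trans i c.state c.elapsed j * g ⟨j, 1, 0⟩ = G 0)
    (hrun : ∀ m ≠ 0, g ⟨c.state, c.elapsed, m⟩ = G m) :
    B.armStep i c play g = G (c.rem - 1) := by
  have ho : B.occupied i c play = c.rem := by simp [occupied, hr]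
  rw [armStep, if_neg hp, zero_add, B.armExp_of_occupied_ne_zero (by lia) hend hrun, ho]

end ArmStep

/-! ### Induction along the process -/

variable {c : BanditConfig K} {a : Finset (Fin n)} {H : BanditHistory K} {s : ∀ i, Fin (K i)}

theorem mem_busy : i ∈ busy c ↔ (c i).rem ≠ 0 := by
  simp [busy]

theorem next_of_notMem (hi : i ∉ a ∪ busy c) (s : ∀ i, Fin (K i)) :
    B.next c a s i = ⟨(c i).state, (c i).elapsed + 1, 0⟩ := by
  simp only [Finset.mem_union, mem_busy, not_or, not_not] at hi
  simp [next, armNext, occupied, hi]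

theorem next_of_mem (hi : i ∈ a ∪ busy c) (s : ∀ i, Fin (K i)) :
    B.next c a s i = ⟨s i, 1, 0⟩ ∨
      ∃ m ≠ 0, B.next c a s i = ⟨(c i).state, (c i).elapsed, m⟩ := by
  have hL := B.L_pos i (c i).state
  have ho : B.occupied i (c i) (i ∈ a) ≠ 0 := by
    rw [Finset.mem_union, mem_busy] at hi
    unfold occupied
    split_ifs <;> grind
  by_cases h1 : B.occupied i (c i) (i ∈ a) = 1
  · simp [next, armNext, h1]
  · exact .inr ⟨B.occupied i (c i) (i ∈ a) - 1, by lia, by simp [next, armNext, ho, h1]⟩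

theorem busy_next_subset (c : BanditConfig K) (a : Finset (Fin n)) (s : ∀ i, Fin (K i)) :
    busy (B.next c a s) ⊆ a ∪ busy c := by
  intro i hi
  by_contra hia
  rw [mem_busy, B.next_of_notMem hia] at hi
  exact hi rfl

variable {B} {π : B.Policy}

theorem Legal.card_union_busy (ha : B.Legal c a) :
    (a ∪ busy c).card = a.card + (busy c).card :=
  Finset.card_union_of_disjoint <| Finset.disjoint_left.2 fun i hi hb =>
    mem_busy.1 hb (ha.1 i hi)

theorem Legal.card_union_busy_le (ha : B.Legal c a) (hc : (busy c).card ≤ B.M) :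
    (a ∪ busy c).card ≤ B.M := by
  have := ha.card_union_busy
  have := ha.2
  lia

theorem Policy.Reachable.invariant {I : BanditConfig K → Prop} (h0 : I (start s))
    (hstep : ∀ H c a s', π.Reachable s H c → I c → π.law H c a ≠ 0 → I (B.next c a s'))
    (hc : π.Reachable s H c) : I c := by
  induction hc with
  | init => exact h0
  | step H c a s' hr ha _ ih => exact hstep H c a s' hr ih ha

theorem Policy.Reachable.one_le_elapsed (hc : π.Reachable s H c) (i : Fin n) :
    1 ≤ (c i).elapsed := by
  refine hc.invariant (I := fun c => 1 ≤ (c i).elapsed) le_rfl fun H c a s' _ hc _ => ?_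
  simp only [next, armNext]
  split_ifs
  exacts [Nat.le_add_left _ _, le_rfl, hc]

theorem Policy.Reachable.rem_le (hc : π.Reachable s H c) (i : Fin n) :
    (c i).rem ≤ B.L i (c i).state := by
  refine hc.invariant (I := fun c => (c i).rem ≤ B.L i (c i).state) (Nat.zero_le _)
    fun H c a s' _ hc _ => ?_
  simp only [next, armNext, occupied]
  split_ifs <;> lia

theorem Policy.Reachable.card_busy_le (hc : π.Reachable s H c) : (busy c).card ≤ B.M := by
  refine hc.invariant (I := fun c => (busy c).card ≤ B.M) (by simp [busy, start])
    fun H c a s' _ hc ha => ?_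
  exact (Finset.card_le_card (B.busy_next_subset c a s')).trans
    ((π.legal H c a ha).card_union_busy_le hc)

theorem Policy.sum_law_mul_const (π : B.Policy) (H : BanditHistory K) (c : BanditConfig K)
    (x : ℝ) : ∑ a, (π.law H c a).toReal * x = x := by
  have hsum := (π.law H c).tsum_coe
  rw [tsum_fintype] at hsum
  rw [← Finset.sum_mul, ← ENNReal.toReal_sum fun a _ => (π.law H c).apply_ne_top a, hsum,
    ENNReal.toReal_one, one_mul]

theorem Policy.sum_law_mul_mono {F G : Finset (Fin n) → ℝ}
    (hFG : ∀ a, π.law H c a ≠ 0 → F a ≤ G a) :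
    ∑ a, (π.law H c a).toReal * F a ≤ ∑ a, (π.law H c a).toReal * G a := by
  refine Finset.sum_le_sum fun a _ => ?_
  rcases eq_or_ne (π.law H c a) 0 with ha | ha
  · simp [ha]
  · exact mul_le_mul_of_nonneg_left (hFG a ha) ENNReal.toReal_nonneg

theorem Policy.Reachable.expNext_mono (hc : π.Reachable s H c) (ha : π.law H c a ≠ 0)
    {F G : BanditConfig K → ℝ} (hFG : ∀ c', π.Reachable s ((c, a) :: H) c' → F c' ≤ G c') :
    B.expNext c a F ≤ B.expNext c a G := by
  refine Finset.sum_le_sum fun s' _ => ?_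
  rcases (B.jointProb_nonneg hc.one_le_elapsed a s').eq_or_lt with hs | hs
  · simp [← hs]
  · exact mul_le_mul_of_nonneg_left (hFG _ (.step H c a s' hc ha hs)) hs.le

theorem Policy.value_succ (π : B.Policy) (T : ℕ) (H : BanditHistory K) (c : BanditConfig K) :
    π.value (T + 1) H c = ∑ a, (π.law H c a).toReal *
      (B.reward c a + B.expNext c a fun c' => π.value T ((c, a) :: H) c') :=
  rfl

theorem Policy.value_le_of_potential (Ψ : ℕ → BanditConfig K → ℝ)
    (h0 : ∀ H c, π.Reachable s H c → 0 ≤ Ψ 0 c)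
    (hstep : ∀ T H c a, π.Reachable s H c → π.law H c a ≠ 0 →
      B.reward c a + B.expNext c a (Ψ T) ≤ Ψ (T + 1) c)
    (T : ℕ) (hc : π.Reachable s H c) : π.value T H c ≤ Ψ T c := by
  induction T generalizing H c with
  | zero => exact h0 H c hc
  | succ T ih =>
    rw [value_succ, ← π.sum_law_mul_const H c (Ψ (T + 1) c)]
    exact sum_law_mul_mono fun a ha =>
      (add_le_add_right (hc.expNext_mono ha fun c' hc' => ih hc') _).trans (hstep T H c a hc ha)

theorem Policy.le_value_of_potential (Ψ : ℕ → BanditConfig K → ℝ)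
    (h0 : ∀ H c, π.Reachable s H c → Ψ 0 c ≤ 0)
    (hstep : ∀ T H c a, π.Reachable s H c → π.law H c a ≠ 0 →
      Ψ (T + 1) c ≤ B.reward c a + B.expNext c a (Ψ T))
    (T : ℕ) (hc : π.Reachable s H c) : Ψ T c ≤ π.value T H c := by
  induction T generalizing H c with
  | zero => exact h0 H c hc
  | succ T ih =>
    rw [value_succ, ← π.sum_law_mul_const H c (Ψ (T + 1) c)]
    exact sum_law_mul_mono fun a ha =>
      (hstep T H c a hc ha).trans (add_le_add_right (hc.expNext_mono ha fun c' hc' => ih hc') _)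

end

/-! ### Potentials -/

section

variable (B : MonotoneBandit n K) (D : DualSolution K) {i : Fin n}

/-- Potential of arm `i` for the dual solution `D`, used as a Lyapunov function: an idle arm in
state `k` carries the credit `u k t` for the `t` steps since the end of its last play; a running
play owes `λ + h_i` for each of its remaining steps. -/
noncomputable def potential (i : Fin n) (u : Fin (K i) → ℕ → ℝ) (c : ArmStatus (K i)) : ℝ :=
  if c.rem = 0 then D.p i c.state + u c.state c.elapsed
  else D.p i c.state + B.f i c.state c.elapsed * B.deltaP D i c.state - c.rem * (D.lam + D.h i)

section Drift

variable {D} {u : Fin (K i) → ℕ → ℝ} {c : ArmStatus (K i)} {play : Prop} [Decidable play]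

theorem armStep_potential_of_idle (hr : c.rem = 0) (hp : ¬ play) :
    B.armStep i c play (B.potential D i u) =
      B.potential D i u c + (u c.state (c.elapsed + 1) - u c.state c.elapsed) := by
  rw [B.armStep_of_idle hr hp, potential, potential, if_pos hr, if_pos rfl]
  ring

theorem sum_trans_mul_potential (hu : ∀ k, u k 1 = 0) (k : Fin (K i)) (t : ℕ) :
    ∑ j, B.trans i k t j * B.potential D i u ⟨j, 1, 0⟩ =
      D.p i k + B.f i k t * B.deltaP D i k - (0 : ℕ) * (D.lam + D.h i) := by
  simp [potential, hu, sum_trans_mul, deltaP_eq_escapeGain]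

theorem armStep_potential_of_play (hu : ∀ k, u k 1 = 0) (hr : c.rem = 0) (hp : play) :
    B.armStep i c play (B.potential D i u) =
      B.potential D i u c +
        (B.r i c.state + B.f i c.state c.elapsed * B.deltaP D i c.state -
          B.L i c.state * (D.lam + D.h i) - u c.state c.elapsed) + (D.lam + D.h i) := by
  rw [B.armStep_of_play hr hp (B.sum_trans_mul_potential hu _ _) fun m hm => if_neg hm,
    potential, if_pos hr, Nat.cast_sub (B.L_pos i c.state)]
  ring

theorem armStep_potential_of_busy (hu : ∀ k, u k 1 = 0) (hr : c.rem ≠ 0) (hp : ¬ play) :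
    B.armStep i c play (B.potential D i u) = B.potential D i u c + (D.lam + D.h i) := by
  rw [B.armStep_of_busy hr hp (B.sum_trans_mul_potential hu _ _) fun m hm => if_neg hm,
    potential, if_neg hr, Nat.cast_sub (Nat.one_le_iff_ne_zero.2 hr)]
  ring

end Drift

variable {D}

theorem abs_f_mul_le (i : Fin n) (k : Fin (K i)) {t : ℕ} (ht : 1 ≤ t) (x : ℝ) :
    |B.f i k t * x| ≤ |x| := by
  rw [abs_mul, abs_of_nonneg (B.f_nonneg i k t ht)]
  exact mul_le_of_le_one_left (abs_nonneg _) (B.f_le_one i k t ht)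

variable {B}

theorem BalanceFeasible.exists_le_potential (hD : B.BalanceFeasible D)
    {u : Fin (K i) → ℕ → ℝ} (hu : ∀ k, ∀ t ≥ 1, 0 ≤ u k t) :
    ∃ C, ∀ c : ArmStatus (K i), 1 ≤ c.elapsed → c.rem ≤ B.L i c.state →
      C ≤ B.potential D i u c := by
  obtain ⟨C, hC⟩ := Finite.exists_ge fun k =>
    D.p i k - |B.deltaP D i k| - B.L i k * (D.lam + D.h i)
  refine ⟨C, fun c he hr => (hC c.state).trans ?_⟩
  have hlh : 0 ≤ D.lam + D.h i := add_nonneg hD.lam_nonneg (hD.h_nonneg i)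
  have hcost : (c.rem : ℝ) * (D.lam + D.h i) ≤ B.L i c.state * (D.lam + D.h i) := by gcongr
  have hcost' : 0 ≤ (c.rem : ℝ) * (D.lam + D.h i) := by positivity
  have hf := neg_le_of_abs_le (B.abs_f_mul_le i c.state he (B.deltaP D i c.state))
  have habs := abs_nonneg (B.deltaP D i c.state)
  have hcredit := hu c.state c.elapsed he
  unfold potential
  split_ifs <;> linarith

theorem BalanceFeasible.exists_potential_le (hD : B.BalanceFeasible D)
    {u : Fin (K i) → ℕ → ℝ} {b : Fin (K i) → ℝ} (hb : ∀ k, 0 ≤ b k) (hu : ∀ k t, u k t ≤ b k) :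
    ∃ C, ∀ c : ArmStatus (K i), 1 ≤ c.elapsed → B.potential D i u c ≤ C := by
  obtain ⟨C, hC⟩ := Finite.exists_le fun k => D.p i k + |B.deltaP D i k| + b k
  refine ⟨C, fun c he => le_trans ?_ (hC c.state)⟩
  have hcost : 0 ≤ (c.rem : ℝ) * (D.lam + D.h i) :=
    mul_nonneg (Nat.cast_nonneg _) (add_nonneg hD.lam_nonneg (hD.h_nonneg i))
  have hf := le_of_abs_le (B.abs_f_mul_le i c.state he (B.deltaP D i c.state))
  have habs := abs_nonneg (B.deltaP D i c.state)
  have hcredit := hu c.state c.elapsed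
  have hb' := hb c.state
  unfold potential
  split_ifs <;> linarith

/-! ### The upper bound for all policies -/

/-- The credit `(t - 1) h_i` that an arm has collected after being idle for `t` steps. -/
noncomputable def waitingCredit (D : DualSolution K) (i : Fin n) (_ : Fin (K i)) (t : ℕ) : ℝ :=
  (t - 1) * D.h i

theorem BalanceFeasible.armStep_potential_le (hD : B.BalanceFeasible D) {c : ArmStatus (K i)}
    {play : Prop} [Decidable play] (he : 1 ≤ c.elapsed) (hp : play → c.rem = 0) :
    B.armStep i c play (B.potential D i (waitingCredit D i)) ≤
      B.potential D i (waitingCredit D i) c + D.h i +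
        if play ∨ c.rem ≠ 0 then D.lam else 0 := by
  have hu : ∀ k, waitingCredit D i k 1 = 0 := by simp [waitingCredit]
  rcases eq_or_ne c.rem 0 with hr | hr
  · by_cases hplay : play
    · rw [B.armStep_potential_of_play hu hr hplay, if_pos (.inl hplay), waitingCredit]
      linarith [hD.reward_add_le i c.state he]
    · rw [B.armStep_potential_of_idle hr hplay, if_neg (by simp [hplay, hr])]
      refine le_of_eq ?_
      simp only [waitingCredit]
      push_cast
      ring
  · rw [B.armStep_potential_of_busy hu hr (mt hp hr), if_pos (.inr hr)]
    linarith

theorem BalanceFeasible.drift_le (hD : B.BalanceFeasible D) {c : BanditConfig K}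
    {a : Finset (Fin n)} (he : ∀ i, 1 ≤ (c i).elapsed) (hbusy : (busy c).card ≤ B.M)
    (ha : B.Legal c a) :
    (B.reward c a + B.expNext c a fun c' => ∑ i, B.potential D i (waitingCredit D i) (c' i)) ≤
      B.balanceObj D + ∑ i, B.potential D i (waitingCredit D i) (c i) := by
  have hcard : ((a ∪ busy c).card : ℝ) * D.lam ≤ B.M * D.lam :=
    mul_le_mul_of_nonneg_right (mod_cast ha.card_union_busy_le hbusy) hD.lam_nonneg
  have hmem : ∀ i, i ∈ a ∨ (c i).rem ≠ 0 ↔ i ∈ a ∪ busy c := fun i => by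
    rw [Finset.mem_union, mem_busy]
  have hsum := Finset.sum_le_sum fun i (_ : i ∈ Finset.univ) =>
    hD.armStep_potential_le (he i) (ha.1 i)
  simp only [sum_armStep, Finset.univ_inter, Finset.sum_add_distrib, hmem, Finset.sum_ite_mem,
    Finset.sum_const, nsmul_eq_mul] at hsum
  unfold balanceObj
  linarith

theorem BalanceFeasible.exists_value_le (hD : B.BalanceFeasible D) (π : B.Policy)
    (s : ∀ i, Fin (K i)) : ∃ C, ∀ T, π.value T [] (start s) ≤ T * B.balanceObj D + C := by
  have hbdd : ∀ i, ∃ C, ∀ c : ArmStatus (K i), 1 ≤ c.elapsed → c.rem ≤ B.L i c.state →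
      C ≤ B.potential D i (waitingCredit D i) c := fun i =>
    hD.exists_le_potential fun _ t ht =>
      mul_nonneg (sub_nonneg.2 (mod_cast ht)) (hD.h_nonneg i)
  choose C hC using hbdd
  refine ⟨-∑ i, C i + ∑ i, B.potential D i (waitingCredit D i) (start s i), fun T => ?_⟩
  rw [← add_assoc]
  refine π.value_le_of_potential (s := s) (fun T c => T * B.balanceObj D + -∑ i, C i +
    ∑ i, B.potential D i (waitingCredit D i) (c i)) (fun H c hc => ?_)
    (fun T H c a hc ha => ?_) T .init
  · have := Finset.sum_le_sum fun i (_ : i ∈ Finset.univ) =>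
      hC i (c i) (hc.one_le_elapsed i) (hc.rem_le i)
    simp only [Nat.cast_zero]
    linarith
  · have := hD.drift_le hc.one_le_elapsed hc.card_busy_le (π.legal H c a ha)
    rw [expNext_const_add]
    push_cast
    linarith

theorem Policy.value_nonneg (π : B.Policy) (s : ∀ i, Fin (K i)) (T : ℕ) :
    0 ≤ π.value T [] (start s) := by
  refine π.le_value_of_potential (s := s) (fun _ _ => 0) (fun _ _ _ => le_rfl)
    (fun _ H c a _ _ => ?_) T .init
  have : 0 ≤ B.reward c a := Finset.sum_nonneg fun i _ => B.r_nonneg i _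
  simpa [expNext] using this

theorem BalanceFeasible.eventually_average_le (hD : B.BalanceFeasible D) (π : B.Policy)
    (s : ∀ i, Fin (K i)) {ε : ℝ} (hε : 0 < ε) :
    ∀ᶠ T in atTop, π.average s T ≤ B.balanceObj D + ε := by
  obtain ⟨C, hC⟩ := hD.exists_value_le π s
  filter_upwards [(tendsto_const_div_atTop_nhds_zero_nat C).eventually_lt_const hε,
    eventually_gt_atTop 0] with T hCT hT
  have hT' : (0 : ℝ) < T := mod_cast hT
  rw [div_lt_iff₀ hT'] at hCT
  rw [Policy.average, div_le_iff₀ hT']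
  linarith [hC T]

theorem BalanceFeasible.limsup_average_le (hD : B.BalanceFeasible D) (π : B.Policy)
    (s : ∀ i, Fin (K i)) : limsup (fun T : ℕ => π.average s T) atTop ≤ B.balanceObj D := by
  have hbdd : IsBoundedUnder (· ≥ ·) atTop fun T : ℕ => π.average s T :=
    isBoundedUnder_of ⟨0, fun T => div_nonneg (π.value_nonneg s T) (Nat.cast_nonneg T)⟩
  exact le_of_forall_pos_le_add fun ε hε =>
    limsup_le_of_le hbdd.isCoboundedUnder_le (hD.eventually_average_le π s hε)

/-! ### Weak duality for Whittle's program -/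

variable (B) in
/-- Rate of the attempts to escape from state `k` of arm `i` under the solution `x` of Whittle's
program; it is multiplied by `q i k j` to give the rate of the moves to `j`. -/
noncomputable def escapeRate (x : ∀ i, Fin (K i) → ℕ → ℝ) (i : Fin n) (k : Fin (K i)) : ℝ :=
  ∑' t, x i k t * B.f i k t

namespace WhittleFeasible

variable {x : ∀ i, Fin (K i) → ℕ → ℝ}

theorem summable_apply (hx : B.WhittleFeasible x) (i : Fin n) (k : Fin (K i)) :
    Summable (x i k) := by
  refine (hx.summable i k).of_nonneg_of_le (hx.nonneg i k) fun t => ?_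
  rcases t.eq_zero_or_pos with rfl | ht
  · simp [hx.zero]
  · exact le_mul_of_one_le_left (hx.nonneg i k t) (mod_cast ht)

theorem summable_mul_f (hx : B.WhittleFeasible x) (i : Fin n) (k : Fin (K i)) :
    Summable fun t => x i k t * B.f i k t := by
  refine (hx.summable_apply i k).of_norm_bounded fun t => ?_
  rcases t.eq_zero_or_pos with rfl | ht
  · simp [hx.zero]
  · rw [mul_comm, Real.norm_eq_abs]
    exact (B.abs_f_mul_le i k ht _).trans_eq (abs_of_nonneg (hx.nonneg i k t))

theorem summable_duration_mul (hx : B.WhittleFeasible x) (i : Fin n) (k : Fin (K i)) :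
    Summable fun t : ℕ => ((t : ℝ) + B.L i k - 1) * x i k t :=
  ((hx.summable i k).add ((hx.summable_apply i k).mul_left ((B.L i k : ℝ) - 1))).congr
    fun t => by ring

theorem flow_escapeRate (hx : B.WhittleFeasible x) (i : Fin n) (k : Fin (K i)) :
    ∑ j with j ≠ k, B.q i k j * B.escapeRate x i k =
      ∑ j with j ≠ k, B.q i j k * B.escapeRate x i j := by
  simpa only [escapeRate, ← tsum_mul_left, mul_left_comm, mul_assoc] using hx.flow i k

theorem sum_escapeGain_mul_escapeRate (hx : B.WhittleFeasible x) (i : Fin n) (v : Fin (K i) → ℝ) :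
    ∑ k, B.escapeGain i k v * B.escapeRate x i k = 0 := by
  have hk : ∀ k, B.escapeGain i k v * B.escapeRate x i k =
      ∑ j with j ≠ k, v j * (B.q i k j * B.escapeRate x i k) -
        ∑ j with j ≠ k, v k * (B.q i j k * B.escapeRate x i j) := fun k => by
    rw [← Finset.mul_sum, ← hx.flow_escapeRate, escapeGain_apply, Finset.sum_mul, Finset.mul_sum,
      ← Finset.sum_sub_distrib]
    exact Finset.sum_congr rfl fun j _ => by ring
  simp only [hk, Finset.sum_sub_distrib, Finset.sum_filter]
  rw [Finset.sum_comm, sub_eq_zero]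
  simp only [ne_comm]

theorem tsum_reward_le (hx : B.WhittleFeasible x) (hD : B.BalanceFeasible D) (i : Fin n)
    (k : Fin (K i)) :
    ∑' t, B.r i k * x i k t ≤
      D.lam * (∑' t, B.L i k * x i k t) + D.h i * (∑' t : ℕ, (t + B.L i k - 1) * x i k t) -
        B.deltaP D i k * B.escapeRate x i k := by
  have hL := ((hx.summable_apply i k).mul_left (B.L i k : ℝ)).hasSum.mul_left D.lam
  have ht := (hx.summable_duration_mul i k).hasSum.mul_left (D.h i)
  have hf := (hx.summable_mul_f i k).hasSum.mul_left (B.deltaP D i k)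
  refine hasSum_le (fun t => ?_) ((hx.summable_apply i k).mul_left (B.r i k)).hasSum
    ((hL.add ht).sub hf)
  rcases t.eq_zero_or_pos with rfl | ht
  · simp [hx.zero]
  · linarith [mul_le_mul_of_nonneg_right (hD.reward_add_le i k ht) (hx.nonneg i k t)]

end WhittleFeasible

theorem BalanceFeasible.whittleObj_le (hD : B.BalanceFeasible D) {x : ∀ i, Fin (K i) → ℕ → ℝ}
    (hx : B.WhittleFeasible x) : B.whittleObj x ≤ B.balanceObj D := by
  have hflow : ∀ i, ∑ k, B.deltaP D i k * B.escapeRate x i k = 0 := fun i => by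
    simpa only [deltaP_eq_escapeGain] using hx.sum_escapeGain_mul_escapeRate i (D.p i)
  have hplayers := mul_le_mul_of_nonneg_left hx.players hD.lam_nonneg
  have hidle := Finset.sum_le_sum fun i (_ : i ∈ Finset.univ) =>
    mul_le_mul_of_nonneg_left (hx.idle i) (hD.h_nonneg i)
  have hsum : B.whittleObj x ≤ _ :=
    Finset.sum_le_sum fun i _ => Finset.sum_le_sum fun k _ => hx.tsum_reward_le hD i k
  simp only [Finset.sum_sub_distrib, Finset.sum_add_distrib, ← Finset.mul_sum, hflow,
    sub_zero] at hsum
  simp only [mul_one] at hidle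
  unfold balanceObj
  linarith

end

/-! ### Invariants of the balanced index policy -/

section

variable (B : MonotoneBandit n K) (D : DualSolution K) {i : Fin n}

/-- The arms that are played by the players not bound to an arm of `U₁`. -/
noncomputable def sharedArms : Finset (Fin n) :=
  if (B.U₁ D).card < B.M then B.U₂ D else ∅

open Classical in
/-- The shared arms in good states, whether or not a play is running. -/
noncomputable def goodArms (c : BanditConfig K) : Finset (Fin n) :=
  (B.sharedArms D).filter fun i => B.Good D i (c i).state

variable {B D}

theorem mem_sharedArms : i ∈ B.sharedArms D ↔ (B.U₁ D).card < B.M ∧ i ∈ B.U₂ D := by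
  unfold sharedArms
  split_ifs with hU <;> simp [hU]

theorem mem_U₂_of_mem_sharedArms (hi : i ∈ B.sharedArms D) : i ∈ B.U₂ D :=
  (mem_sharedArms.1 hi).2

theorem disjoint_sharedArms {A : Finset (Fin n)} (hA : A ⊆ B.U₁ D) :
    Disjoint A (B.sharedArms D) :=
  Finset.disjoint_left.2 fun _ hi hi' =>
    (mem_U₂.1 (mem_U₂_of_mem_sharedArms hi')).1 (hA hi)

theorem mem_goodArms {c : BanditConfig K} :
    i ∈ B.goodArms D c ↔ i ∈ B.sharedArms D ∧ B.Good D i (c i).state := by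
  simp [goodArms]

/-- Properties of the situations that occur under a balanced index policy that continuously plays
the arms in `A`. By `card_le`, no arm in a good state ever has to wait for a player. -/
structure IndexInvariant (D : DualSolution K) (A : Finset (Fin n)) (c : BanditConfig K) :
    Prop where
  elapsed_of_mem : ∀ i ∈ A, (c i).elapsed = 1
  elapsed_of_good : ∀ i ∈ B.goodArms D c, (c i).rem = 0 → (c i).elapsed = 1
  busy_subset : busy c ⊆ A ∪ B.sharedArms D
  card_le : (busy c ∪ A ∪ B.goodArms D c).card ≤ B.M

variable {A : Finset (Fin n)} {c : BanditConfig K} {a : Finset (Fin n)} {s : ∀ i, Fin (K i)}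

theorem BalancedIndexAction.subset_union_busy (ha : B.BalancedIndexAction D A c a) :
    A ⊆ a ∪ busy c := by
  intro i hi
  rw [Finset.mem_union, mem_busy]
  exact or_iff_not_imp_right.2 fun hr => ha.continuous i hi (not_not.1 hr)

theorem BalancedIndexAction.mem_cases (ha : B.BalancedIndexAction D A c a) (hi : i ∈ a) :
    i ∈ A ∨ i ∈ B.sharedArms D ∧
      (B.Good D i (c i).state ∨ B.Ready D i (c i).state (c i).elapsed) :=
  (ha.only i hi).imp_right fun ⟨hU, hi⟩ => hi.elim
    (fun hg => ⟨mem_sharedArms.2 ⟨hU, hg.1⟩, .inl hg.2.2⟩)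
    (fun hr => ⟨mem_sharedArms.2 ⟨hU, hr.1⟩, .inr hr.2.2⟩)

theorem BalancedIndexAction.le_card_union_busy (ha : B.BalancedIndexAction D A c a)
    (hleg : B.Legal c a) (hi : i ∈ B.sharedArms D) (hia : i ∉ a ∪ busy c)
    (hc : B.Good D i (c i).state ∨ B.Ready D i (c i).state (c i).elapsed) :
    B.M ≤ (a ∪ busy c).card := by
  obtain ⟨hU, hi₂⟩ := mem_sharedArms.1 hi
  obtain ⟨hia, hr⟩ := not_or.1 (Finset.mem_union.not.1 hia)
  have hr : (c i).rem = 0 := not_not.1 (mem_busy.not.1 hr)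
  have := mt (ha.idle hU · i (hc.imp (⟨hi₂, hr, ·⟩) (⟨hi₂, hr, ·⟩))) hia
  rw [hleg.card_union_busy]
  lia

namespace IndexInvariant

theorem union_busy_subset (h : B.IndexInvariant D A c) (ha : B.BalancedIndexAction D A c a) :
    a ∪ busy c ⊆ A ∪ B.sharedArms D :=
  Finset.union_subset (fun _ hi => Finset.mem_union.2 ((ha.mem_cases hi).imp_right And.left))
    h.busy_subset

theorem goodArms_subset (h : B.IndexInvariant D A c) (hleg : B.Legal c a)
    (ha : B.BalancedIndexAction D A c a) : B.goodArms D c ⊆ a ∪ busy c := by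
  intro j hj
  by_contra hja
  obtain ⟨hjs, hg⟩ := mem_goodArms.1 hj
  have hfull := ha.le_card_union_busy hleg hjs hja (.inl hg)
  have hj' : B.AvailGood D c j := by
    rw [Finset.mem_union, mem_busy, not_or, not_not] at hja
    exact ⟨mem_U₂_of_mem_sharedArms hjs, hja.2, hg⟩
  have hready : ∀ i ∈ a, ¬ B.AvailReady D c i := fun i hi hr =>
    hja (Finset.mem_union_left _ (ha.exploit ⟨i, hi, hr⟩ j hj'))
  have hsub : a ∪ busy c ⊆ busy c ∪ A ∪ B.goodArms D c := by
    refine Finset.union_subset (fun i hi => ?_)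
      (Finset.subset_union_left.trans Finset.subset_union_left)
    rcases ha.mem_cases hi with hA | ⟨his, hg | hr⟩
    · exact Finset.mem_union_left _ (Finset.mem_union_right _ hA)
    · exact Finset.mem_union_right _ (mem_goodArms.2 ⟨his, hg⟩)
    · exact (hready i hi ⟨mem_U₂_of_mem_sharedArms his, hleg.1 i hi, hr⟩).elim
  have hlt := Finset.card_lt_card
    (Finset.ssubset_iff_of_subset hsub |>.2 ⟨j, Finset.mem_union_right _ hj, hja⟩)
  exact (hfull.trans_lt hlt).not_ge h.card_le

theorem goodArms_next_subset (h : B.IndexInvariant D A c) (hleg : B.Legal c a)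
    (ha : B.BalancedIndexAction D A c a) (s : ∀ i, Fin (K i)) :
    B.goodArms D (B.next c a s) ⊆ a ∪ busy c := by
  intro i hi
  by_contra hia
  rw [mem_goodArms, B.next_of_notMem hia] at hi
  exact hia (h.goodArms_subset hleg ha (mem_goodArms.2 hi))

theorem next (h : B.IndexInvariant D A c) (hleg : B.Legal c a)
    (ha : B.BalancedIndexAction D A c a) (s : ∀ i, Fin (K i)) :
    B.IndexInvariant D A (B.next c a s) where
  elapsed_of_mem i hi := by
    rcases B.next_of_mem (ha.subset_union_busy hi) s with hn | ⟨m, -, hn⟩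
    · rw [hn]
    · rw [hn]
      exact h.elapsed_of_mem i hi
  elapsed_of_good i hi hr := by
    rcases B.next_of_mem (h.goodArms_next_subset hleg ha s hi) s with hn | ⟨m, hm, hn⟩
    · rw [hn]
    · rw [hn] at hr
      exact absurd hr hm
  busy_subset := (B.busy_next_subset c a s).trans (h.union_busy_subset ha)
  card_le := by
    have hbusy : (busy c).card ≤ B.M :=
      (Finset.card_le_card (Finset.subset_union_left.trans Finset.subset_union_left)).trans
        h.card_le
    exact (Finset.card_le_card (Finset.union_subset
      (Finset.union_subset (B.busy_next_subset c a s) ha.subset_union_busy)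
      (h.goodArms_next_subset hleg ha s))).trans (hleg.card_union_busy_le hbusy)

end IndexInvariant

theorem indexInvariant_start (hcard : A.card = min B.M (B.U₁ D).card)
    (hgood : (B.goodArms D (start s)).card ≤ B.M - (B.U₁ D).card) :
    B.IndexInvariant D A (start s) := by
  have hbusy : busy (start s) = ∅ := by simp [busy, start]
  refine ⟨fun _ _ => rfl, fun _ _ _ => rfl, by simp [hbusy], ?_⟩
  rw [hbusy, Finset.empty_union]
  have := Finset.card_union_le A (B.goodArms D (start s))
  lia

theorem Policy.Reachable.indexInvariant {π : B.Policy} (h0 : B.IndexInvariant D A (start s))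
    (hact : ∀ H c a, π.Reachable s H c → B.IndexInvariant D A c → π.law H c a ≠ 0 →
      B.BalancedIndexAction D A c a)
    {H : BanditHistory K} (hc : π.Reachable s H c) : B.IndexInvariant D A c :=
  hc.invariant h0 fun H c a s₁ hr hc ha =>
    hc.next (π.legal H c a ha) (hact H c a hr hc ha) s₁

/-! ### The reward of the shared arms -/

variable (B D) in
/-- The time `t^i_k` after which an arm of `U₂` that is not good is ready. -/
noncomputable def readyTime (i : Fin n) (k : Fin (K i)) : ℕ :=
  sInf {t | t ∈ B.W i k ∧ B.Tight D i k t}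

open Classical in
variable (B D) in
/-- The credit of an idle arm of `U₂`: unless it is good, it collects `h_i` in each step until it
is ready. (The truncated subtraction is harmless since `t ≥ 1` and `readyTime ≥ 1`.) -/
noncomputable def cappedCredit (i : Fin n) (k : Fin (K i)) (t : ℕ) : ℝ :=
  if B.Good D i k then 0 else (min t (B.readyTime D i k) - 1 : ℕ) * D.h i

theorem cappedCredit_one (k : Fin (K i)) : B.cappedCredit D i k 1 = 0 := by
  have : min 1 (B.readyTime D i k) - 1 = 0 := by lia
  simp [cappedCredit, this]

theorem cappedCredit_mono (hh : 0 ≤ D.h i) (k : Fin (K i)) : Monotone (B.cappedCredit D i k) := by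
  intro t t' ht
  unfold cappedCredit
  split_ifs
  · exact le_rfl
  · gcongr

theorem cappedCredit_le (hh : 0 ≤ D.h i) (k : Fin (K i)) (t : ℕ) :
    B.cappedCredit D i k t ≤ B.readyTime D i k * D.h i := by
  unfold cappedCredit
  split_ifs
  · positivity
  · gcongr
    lia

section Arm

variable {c : ArmStatus (K i)} {play : Prop} [Decidable play]

theorem BalanceOptimal.le_armStep_of_good (hD : B.BalanceOptimal D) (hi : i ∈ B.U₂ D)
    (hg : B.Good D i c.state) (he : c.elapsed = 1) (hr : c.rem = 0) (hp : play) :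
    B.potential D i (B.cappedCredit D i) c + (D.lam + D.h i) ≤
      B.armStep i c play (B.potential D i (B.cappedCredit D i)) := by
  have htight := hD.tight_one_of_good hi hg
  rw [B.armStep_potential_of_play cappedCredit_one hr hp, he, cappedCredit_one]
  unfold Tight at htight
  push_cast at htight
  linarith

theorem Ready.le_armStep (hready : B.Ready D i c.state c.elapsed) (hr : c.rem = 0) (hp : play) :
    B.potential D i (B.cappedCredit D i) c + (D.lam + D.h i) ≤
      B.armStep i c play (B.potential D i (B.cappedCredit D i)) := by
  obtain ⟨hΔ, t₀, ht₀, hle⟩ := hready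
  have h1 : 1 ≤ t₀ := B.W_pos i _ _ ht₀.1.1
  have hg : ¬ B.Good D i c.state := not_lt.2 hΔ
  have hcredit : B.cappedCredit D i c.state c.elapsed = (t₀ - 1) * D.h i := by
    rw [cappedCredit, if_neg hg, readyTime, ht₀.csInf_eq, min_eq_right hle,
      Nat.cast_sub h1, Nat.cast_one]
  have htight := ht₀.1.2
  have hf := mul_le_mul_of_nonneg_right (B.f_le_f i c.state h1 hle) hΔ
  rw [B.armStep_potential_of_play cappedCredit_one hr hp, hcredit]
  unfold Tight at htight
  linarith

theorem BalanceOptimal.le_armStep_of_waiting (hD : B.BalanceOptimal D) (hi : i ∈ B.U₂ D)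
    (he : 1 ≤ c.elapsed) (hg : ¬ B.Good D i c.state) (hready : ¬ B.Ready D i c.state c.elapsed)
    (hr : c.rem = 0) (hp : ¬ play) :
    B.potential D i (B.cappedCredit D i) c + D.h i ≤
      B.armStep i c play (B.potential D i (B.cappedCredit D i)) := by
  have hleast : IsLeast {t | t ∈ B.W i c.state ∧ B.Tight D i c.state t}
      (B.readyTime D i c.state) :=
    ⟨Nat.sInf_mem (hD.exists_tight hi c.state), fun _ => Nat.sInf_le⟩
  have hlt : c.elapsed < B.readyTime D i c.state :=
    lt_of_not_ge fun hle => hready ⟨not_lt.1 hg, _, hleast, hle⟩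
  rw [B.armStep_potential_of_idle hr hp, cappedCredit, cappedCredit, if_neg hg, if_neg hg,
    min_eq_left hlt.le, min_eq_left (show c.elapsed + 1 ≤ _ from hlt), Nat.add_sub_cancel,
    Nat.cast_sub he]
  push_cast
  linarith

end Arm

theorem BalanceOptimal.le_armStep_of_mem (hD : B.BalanceOptimal D) (h : B.IndexInvariant D A c)
    (hA : A ⊆ B.U₁ D) (hleg : B.Legal c a) (ha : B.BalancedIndexAction D A c a)
    (hi : i ∈ B.sharedArms D) (hia : i ∈ a ∪ busy c) :
    B.potential D i (B.cappedCredit D i) (c i) + (D.lam + D.h i) ≤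
      B.armStep i (c i) (i ∈ a) (B.potential D i (B.cappedCredit D i)) := by
  by_cases hp : i ∈ a
  · have hr := hleg.1 i hp
    rcases ha.mem_cases hp with hiA | ⟨-, hg | hready⟩
    · exact absurd hi (Finset.disjoint_left.1 (disjoint_sharedArms hA) hiA)
    · exact hD.le_armStep_of_good (mem_U₂_of_mem_sharedArms hi) hg
        (h.elapsed_of_good i (mem_goodArms.2 ⟨hi, hg⟩) hr) hr hp
    · exact hready.le_armStep hr hp
  · exact (B.armStep_potential_of_busy cappedCredit_one
      (mem_busy.1 ((Finset.mem_union.1 hia).resolve_left hp)) hp).ge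

theorem BalanceOptimal.le_armStep_of_notMem (hD : B.BalanceOptimal D) (hia : i ∉ a ∪ busy c) :
    B.potential D i (B.cappedCredit D i) (c i) ≤
      B.armStep i (c i) (i ∈ a) (B.potential D i (B.cappedCredit D i)) := by
  rw [Finset.mem_union, mem_busy, not_or, not_not] at hia
  rw [B.armStep_potential_of_idle hia.2 hia.1, le_add_iff_nonneg_right, sub_nonneg]
  exact cappedCredit_mono (hD.1.h_nonneg i) _ (Nat.le_succ _)

theorem BalanceOptimal.le_sum_armStep_of_forall_ready (hD : B.BalanceOptimal D)
    (he : ∀ i, 1 ≤ (c i).elapsed) (h : B.IndexInvariant D A c) (hA : A ⊆ B.U₁ D)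
    (hleg : B.Legal c a) (ha : B.BalancedIndexAction D A c a)
    (hready : ∀ i ∈ B.sharedArms D, B.Ready D i (c i).state (c i).elapsed → i ∈ a ∪ busy c) :
    ∑ i ∈ B.sharedArms D, D.h i +
        ∑ i ∈ B.sharedArms D, B.potential D i (B.cappedCredit D i) (c i) ≤
      ∑ i ∈ B.sharedArms D,
        B.armStep i (c i) (i ∈ a) (B.potential D i (B.cappedCredit D i)) := by
  rw [← Finset.sum_add_distrib]
  refine Finset.sum_le_sum fun i hi => ?_
  by_cases hia : i ∈ a ∪ busy c
  · linarith [hD.le_armStep_of_mem h hA hleg ha hi hia, hD.1.lam_nonneg]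
  · have hg : ¬ B.Good D i (c i).state := fun hg =>
      hia (h.goodArms_subset hleg ha (mem_goodArms.2 ⟨hi, hg⟩))
    obtain ⟨hp, hr⟩ := not_or.1 (Finset.mem_union.not.1 hia)
    rw [add_comm]
    exact hD.le_armStep_of_waiting (mem_U₂_of_mem_sharedArms hi) (he i) hg (mt (hready i hi) hia)
      (not_not.1 (mem_busy.not.1 hr)) hp

theorem BalanceOptimal.le_sum_armStep_of_le_card (hD : B.BalanceOptimal D)
    (h : B.IndexInvariant D A c) (hA : A ⊆ B.U₁ D) (hleg : B.Legal c a)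
    (ha : B.BalancedIndexAction D A c a) (hfull : B.M ≤ (a ∪ busy c).card) :
    (B.M - A.card) * D.lam +
        ∑ i ∈ B.sharedArms D, B.potential D i (B.cappedCredit D i) (c i) ≤
      ∑ i ∈ B.sharedArms D,
        B.armStep i (c i) (i ∈ a) (B.potential D i (B.cappedCredit D i)) := by
  set S := B.sharedArms D
  have hsub : a ∪ busy c ⊆ A ∪ S ∩ (a ∪ busy c) := fun i hi => by
    have := h.union_busy_subset ha hi
    grind
  have hcard : B.M ≤ A.card + (S ∩ (a ∪ busy c)).card :=
    hfull.trans ((Finset.card_le_card hsub).trans (Finset.card_union_le _ _))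
  have hcard' : (B.M - A.card : ℝ) ≤ (S ∩ (a ∪ busy c)).card :=
    sub_le_iff_le_add'.2 (mod_cast hcard)
  calc (B.M - A.card) * D.lam + ∑ i ∈ S, B.potential D i (B.cappedCredit D i) (c i)
      ≤ (S ∩ (a ∪ busy c)).card * D.lam + ∑ i ∈ S, B.potential D i (B.cappedCredit D i) (c i) := by
        gcongr
        exact hD.1.lam_nonneg
    _ = ∑ i ∈ S, ((if i ∈ a ∪ busy c then D.lam else 0) +
          B.potential D i (B.cappedCredit D i) (c i)) := by
        rw [Finset.sum_add_distrib, Finset.sum_ite_mem, Finset.sum_const, nsmul_eq_mul]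
    _ ≤ _ := Finset.sum_le_sum fun i hi => ?_
  split_ifs with hia
  · linarith [hD.le_armStep_of_mem h hA hleg ha hi hia, hD.1.h_nonneg i]
  · rw [zero_add]
    exact hD.le_armStep_of_notMem hia

variable (B D A) in
/-- Rate at which the shared arms earn when the arms in `A` are played continuously: either all
other players are busy with them and each earns `λ`, or no shared arm waits for a player and each
arm gains `h_i`. -/
noncomputable def sharedRate : ℝ :=
  min ((B.M - A.card) * D.lam) (∑ i ∈ B.sharedArms D, D.h i)

theorem BalanceOptimal.sharedRate_add_le (hD : B.BalanceOptimal D)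
    (he : ∀ i, 1 ≤ (c i).elapsed) (h : B.IndexInvariant D A c) (hA : A ⊆ B.U₁ D)
    (hleg : B.Legal c a) (ha : B.BalancedIndexAction D A c a) :
    B.sharedRate D A + ∑ i ∈ B.sharedArms D, B.potential D i (B.cappedCredit D i) (c i) ≤
      ∑ i ∈ B.sharedArms D,
        B.armStep i (c i) (i ∈ a) (B.potential D i (B.cappedCredit D i)) := by
  by_cases! hready :
    ∀ i ∈ B.sharedArms D, B.Ready D i (c i).state (c i).elapsed → i ∈ a ∪ busy c
  · exact (add_le_add_left (min_le_right _ _) _).trans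
      (hD.le_sum_armStep_of_forall_ready he h hA hleg ha hready)
  · obtain ⟨j, hj, hjr, hja⟩ := hready
    exact (add_le_add_left (min_le_left _ _) _).trans
      (hD.le_sum_armStep_of_le_card h hA hleg ha (ha.le_card_union_busy hleg hj hja (.inr hjr)))

/-! ### The reward of the balanced index policy -/

variable (B) in
/-- Expected reward in the next `T` steps from an arm that is played over and over, possibly
beginning in the middle of a play. -/
noncomputable def repeatGain (i : Fin n) (T : ℕ) (c : ArmStatus (K i)) : ℝ :=
  if c.rem = 0 then B.repeatValue i T c.state
  else ∑ j, B.trans i c.state c.elapsed j * B.repeatValue i (T - c.rem) j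

section RepeatGain

variable (T : ℕ) {c : ArmStatus (K i)} {play : Prop} [Decidable play]

theorem armStep_repeatGain_of_play (hr : c.rem = 0) (he : c.elapsed = 1) (hp : play) :
    B.armStep i c play (B.repeatGain i T) = B.repeatGain i (T + 1) c := by
  have hL := B.L_pos i c.state
  rw [B.armStep_of_play (G := fun m => ∑ j, B.trans i c.state c.elapsed j *
      B.repeatValue i (T - m) j) hr hp rfl fun m hm => if_neg hm,
    repeatGain, if_pos hr, repeatValue, he, show T - (B.L i c.state - 1) = T + 1 - B.L i c.state
      by lia]

theorem armStep_repeatGain_of_busy (hr : c.rem ≠ 0) (hp : ¬ play) :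
    B.armStep i c play (B.repeatGain i T) = B.repeatGain i (T + 1) c := by
  rw [B.armStep_of_busy (G := fun m => ∑ j, B.trans i c.state c.elapsed j *
      B.repeatValue i (T - m) j) hr hp rfl fun m hm => if_neg hm,
    repeatGain, if_neg hr, show T - (c.rem - 1) = T + 1 - c.rem by lia]

end RepeatGain

theorem IndexInvariant.armStep_repeatGain (h : B.IndexInvariant D A c) (hleg : B.Legal c a)
    (ha : B.BalancedIndexAction D A c a) (hi : i ∈ A) (T : ℕ) :
    B.armStep i (c i) (i ∈ a) (B.repeatGain i T) = B.repeatGain i (T + 1) (c i) := by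
  by_cases hp : i ∈ a
  · exact armStep_repeatGain_of_play T (hleg.1 i hp) (h.elapsed_of_mem i hi) hp
  · exact armStep_repeatGain_of_busy T
      (mem_busy.1 ((Finset.mem_union.1 (ha.subset_union_busy hi)).resolve_left hp)) hp

theorem BalanceOptimal.exists_le_value (hD : B.BalanceOptimal D) {π : B.Policy}
    (h0 : B.IndexInvariant D A (start s)) (hA : A ⊆ B.U₁ D)
    (hact : ∀ H c a, π.Reachable s H c → π.law H c a ≠ 0 → B.BalancedIndexAction D A c a) :
    ∃ C, ∀ T : ℕ, ∑ i ∈ A, B.repeatValue i T (s i) + T * B.sharedRate D A ≤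
      π.value T [] (start s) + C := by
  have hbdd : ∀ i, ∃ C, ∀ c : ArmStatus (K i), 1 ≤ c.elapsed →
      B.potential D i (B.cappedCredit D i) c ≤ C := fun i =>
    hD.1.exists_potential_le (fun k => mul_nonneg (Nat.cast_nonneg _) (hD.1.h_nonneg i))
      (cappedCredit_le (hD.1.h_nonneg i))
  choose C hC using hbdd
  set S := B.sharedArms D
  set Φ : BanditConfig K → ℝ := fun c => ∑ i ∈ S, B.potential D i (B.cappedCredit D i) (c i)
  have hvalue : ∀ T : ℕ, T * B.sharedRate D A + -∑ i ∈ S, C i +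
      (∑ i ∈ A, B.repeatGain i T (start s i) + Φ (start s)) ≤ π.value T [] (start s) := fun T => by
    refine π.le_value_of_potential (s := s) (fun T c => T * B.sharedRate D A + -∑ i ∈ S, C i +
      (∑ i ∈ A, B.repeatGain i T (c i) + Φ c)) (fun H c hc => ?_) (fun T H c a hc ha => ?_) T .init
    · have hΦ : Φ c ≤ ∑ i ∈ S, C i :=
        Finset.sum_le_sum fun i _ => hC i (c i) (hc.one_le_elapsed i)
      simpa [repeatGain, repeatValue] using hΦ
    · have hinv := hc.indexInvariant h0 fun H c a hc _ => hact H c a hc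
      have hleg := π.legal H c a ha
      have hshared := hD.sharedRate_add_le hc.one_le_elapsed hinv hA hleg (hact H c a hc ha)
      have hrepeat := Finset.sum_congr rfl fun i hi =>
        hinv.armStep_repeatGain hleg (hact H c a hc ha) (i := i) hi T
      have hstep := B.sum_armStep_add_sum_armStep_le c a (disjoint_sharedArms hA)
        (fun i => B.repeatGain i T) fun i => B.potential D i (B.cappedCredit D i)
      rw [expNext_const_add]
      push_cast
      linarith
  refine ⟨∑ i ∈ S, C i - Φ (start s), fun T => ?_⟩
  have := hvalue T
  simp only [start, repeatGain, if_true] at this ⊢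
  linarith

theorem BalanceFeasible.lam_le_sum_add_sharedRate (hD : B.BalanceFeasible D) (hA : A ⊆ B.U₁ D)
    (hcard : A.card = min B.M (B.U₁ D).card) :
    B.M * D.lam ≤ ∑ i ∈ A, (D.lam + D.h i) + B.sharedRate D A := by
  have hh : 0 ≤ ∑ i ∈ A, D.h i := Finset.sum_nonneg fun i _ => hD.h_nonneg i
  rw [← sub_le_iff_le_add', sharedRate, le_min_iff, Finset.sum_add_distrib, Finset.sum_const,
    nsmul_eq_mul]
  refine ⟨by linarith, ?_⟩
  rcases lt_or_ge (B.U₁ D).card B.M with hU | hU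
  · have hAU : A = B.U₁ D := Finset.eq_of_subset_of_card_le hA (by lia)
    have hsub : ∑ i, D.h i = ∑ i ∈ A, D.h i + ∑ i ∈ B.sharedArms D, D.h i := by
      rw [← Finset.sum_union (disjoint_sharedArms hA)]
      refine (Finset.sum_subset (Finset.subset_univ _) fun i _ hi => ?_).symm
      rw [hAU, Finset.mem_union, mem_sharedArms, mem_U₂] at hi
      exact le_antisymm (by grind) (hD.h_nonneg i)
    have hlam : 0 ≤ (A.card : ℝ) * D.lam := mul_nonneg (Nat.cast_nonneg _) hD.lam_nonneg
    rw [hD.balance, hsub]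
    linarith
  · have hAM : A.card = B.M := by lia
    have : 0 ≤ ∑ i ∈ B.sharedArms D, D.h i := Finset.sum_nonneg fun i _ => hD.h_nonneg i
    rw [hAM]
    linarith

end

section

variable {B : MonotoneBandit n K} {D : DualSolution K}

theorem BalanceOptimal.eventually_le_average (hD : B.BalanceOptimal D) {π : B.Policy}
    {s : ∀ i, Fin (K i)} (hπ : B.IsBalancedIndex D s π) {ε : ℝ} (hε : 0 < ε) :
    ∀ᶠ T in atTop, B.M * D.lam - ε ≤ π.average s T := by
  obtain ⟨A, hA, hcard, hluc, hgood, hact⟩ := hπ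
  have hgood' : (B.goodArms D (start s)).card ≤ B.M - (B.U₁ D).card := by
    unfold goodArms sharedArms
    split_ifs with hU
    exacts [hgood hU, by simp]
  obtain ⟨C, hC⟩ := hD.exists_le_value (indexInvariant_start hcard hgood') hA hact
  have hrepeat := eventually_sum_sub_le (l := atTop) (A := A)
    (fun i _ => isBoundedUnder_of ⟨0, fun T : ℕ =>
      div_nonneg (B.repeatValue_nonneg i T (s i)) (Nat.cast_nonneg T)⟩) hluc (half_pos hε)
  filter_upwards [hrepeat,
    (tendsto_const_div_atTop_nhds_zero_nat C).eventually_lt_const (half_pos hε),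
    eventually_gt_atTop 0] with T hrT hCT hT
  have hT' : (0 : ℝ) < T := mod_cast hT
  have hvalue : ∑ i ∈ A, B.repeatValue i T (s i) / T + B.sharedRate D A - C / T ≤
      π.average s T := by
    rw [← Finset.sum_div, Policy.average, le_div_iff₀ hT']
    field_simp
    linarith [hC T]
  linarith [hD.1.lam_le_sum_add_sharedRate hA hcard]

theorem BalanceOptimal.balanceObj_le (hD : B.BalanceOptimal D) {π : B.Policy}
    {s : ∀ i, Fin (K i)} (hπ : B.IsBalancedIndex D s π) :
    B.balanceObj D ≤ 2 * liminf (fun T : ℕ => π.average s T) atTop := by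
  have hbdd : IsBoundedUnder (· ≤ ·) atTop fun T : ℕ => π.average s T :=
    ⟨B.balanceObj D + 1, eventually_map.2 (hD.1.eventually_average_le π s one_pos)⟩
  rw [hD.1.balanceObj_eq]
  refine mul_le_mul_of_nonneg_left (le_of_forall_pos_le_add fun ε hε => ?_) zero_le_two
  exact sub_le_iff_le_add.1 (le_liminf_of_le hbdd.isCoboundedUnder_ge
    (hD.eventually_le_average hπ hε))

end

/-! ### Existence of balanced index policies -/

section

variable {B : MonotoneBandit n K} {D : DualSolution K}
  {A : Finset (Fin n)} {c : BanditConfig K}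

open Classical in
theorem IndexInvariant.exists_action (h : B.IndexInvariant D A c) (hA : A ⊆ B.U₁ D) :
    ∃ a, B.Legal c a ∧ B.BalancedIndexAction D A c a := by
  set G := B.goodArms D c
  set R := (B.sharedArms D).filter fun i => B.Ready D i (c i).state (c i).elapsed
  have hrem : ∀ {i}, i ∉ busy c ↔ (c i).rem = 0 := mem_busy.not.trans not_not
  have hG : ∀ {i}, i ∈ G ∧ i ∉ busy c ↔ (B.U₁ D).card < B.M ∧ B.AvailGood D c i := by
    simp only [G, mem_goodArms, mem_sharedArms, hrem, AvailGood]
    tauto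
  have hR : ∀ {i}, i ∈ R ∧ i ∉ busy c ↔ (B.U₁ D).card < B.M ∧ B.AvailReady D c i := by
    simp only [R, Finset.mem_filter, mem_sharedArms, hrem, AvailReady]
    tauto
  have hcard : ((A ∪ G) \ busy c).card ≤ B.M - (busy c).card := by
    have := h.card_le
    rw [Finset.union_assoc, ← Finset.union_sdiff_self_eq_union,
      Finset.card_union_of_disjoint Finset.disjoint_sdiff] at this
    lia
  have hsub : (A ∪ G) \ busy c ⊆ (A ∪ G ∪ R) \ busy c :=
    Finset.sdiff_subset_sdiff Finset.subset_union_left le_rfl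
  obtain ⟨a, hsa, hat, ha⟩ := Finset.exists_subsuperset_card_eq hsub
    (le_min (Finset.card_le_card hsub) hcard) (min_le_left _ _)
  refine ⟨a, ⟨fun i hi => hrem.1 (Finset.mem_sdiff.1 (hat hi)).2, ha.trans_le (min_le_right _ _)⟩,
    fun i hi hr => hsa ?_, fun i hi => ?_, ?_, fun hU hlt j hj => ?_⟩
  · grind
  · grind
  · rintro ⟨i, hi, hr⟩ j hj
    have hiA : i ∉ A := fun hiA => (mem_U₂.1 hr.1).1 (hA hiA)
    grind
  · have hfull : a = (A ∪ G ∪ R) \ busy c := Finset.eq_of_subset_of_card_le hat (by lia)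
    grind

theorem exists_deltaP_nonneg (B : MonotoneBandit n K) (D : DualSolution K) (i : Fin n) :
    ∃ k, 0 ≤ B.deltaP D i k := by
  have : Nonempty (Fin (K i)) := ⟨⟨0, B.K_pos i⟩⟩
  obtain ⟨k, hk⟩ := Finite.exists_min (D.p i)
  exact ⟨k, Finset.sum_nonneg fun j _ => mul_nonneg (B.q_nonneg i k j) (sub_nonneg.2 (hk j))⟩

open Classical in
variable (B D A) in
/-- The deterministic policy that follows the rules of the balanced index policy wherever they
can be followed, and begins no play elsewhere. -/
noncomputable def indexPolicy : B.Policy where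
  law _ c := PMF.pure
    (if h : ∃ a, B.Legal c a ∧ B.BalancedIndexAction D A c a then h.choose else ∅)
  legal _ c a ha := by
    rw [← PMF.mem_support_iff, PMF.mem_support_pure_iff] at ha
    subst ha
    split_ifs with h
    · exact h.choose_spec.1
    · simp [Legal]

theorem balancedIndexAction_of_indexPolicy (hex : ∃ a, B.Legal c a ∧ B.BalancedIndexAction D A c a)
    {H : BanditHistory K} {a : Finset (Fin n)} (ha : (B.indexPolicy D A).law H c a ≠ 0) :
    B.BalancedIndexAction D A c a := by
  rw [← PMF.mem_support_iff, indexPolicy, PMF.mem_support_pure_iff, dif_pos hex] at ha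
  exact ha ▸ hex.choose_spec.2

theorem exists_isBalancedIndex (B : MonotoneBandit n K) (D : DualSolution K) :
    ∃ (s : ∀ i, Fin (K i)) (π : B.Policy), B.IsBalancedIndex D s π := by
  classical
  have hs : ∀ i, ∃ k, (i ∈ B.U₁ D → B.Lucrative D i k) ∧ (i ∉ B.U₁ D → ¬ B.Good D i k) := by
    intro i
    by_cases hi : i ∈ B.U₁ D
    · exact (mem_U₁.1 hi).imp fun k hk => ⟨fun _ => hk, absurd hi⟩
    · exact (B.exists_deltaP_nonneg D i).imp fun k hk => ⟨(absurd · hi), fun _ => hk.not_gt⟩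
  choose s hlucrative hnotGood using hs
  obtain ⟨A, hA, hcard⟩ := Finset.exists_subset_card_eq (min_le_right B.M (B.U₁ D).card)
  have hgood : ∀ i ∈ B.U₂ D, ¬ B.Good D i (s i) := fun i hi => hnotGood i (mem_U₂.1 hi).1
  have hgoodArms : B.goodArms D (start s) = ∅ := Finset.eq_empty_of_forall_notMem fun i hi =>
    hgood i (mem_U₂_of_mem_sharedArms (mem_goodArms.1 hi).1) (mem_goodArms.1 hi).2
  have h0 : B.IndexInvariant D A (start s) := indexInvariant_start hcard (by simp [hgoodArms])
  have hact : ∀ {H c a}, B.IndexInvariant D A c → (B.indexPolicy D A).law H c a ≠ 0 →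
      B.BalancedIndexAction D A c a := fun hc =>
    balancedIndexAction_of_indexPolicy (hc.exists_action hA)
  refine ⟨s, B.indexPolicy D A, A, hA, hcard, fun i hi => hlucrative i (hA hi), fun _ => ?_,
    fun H c a hc => hact (hc.indexInvariant h0 fun H c a _ => hact)⟩
  rw [Finset.filter_false_of_mem hgood, Finset.card_empty]
  exact Nat.zero_le _

end

end MonotoneBandit

theorem mainTheorem7 {n : ℕ} {K : Fin n → ℕ} (B : MonotoneBandit n K) :
    (∃ D : DualSolution K, B.BalanceOptimal D) ∧
    ∀ D : DualSolution K, B.BalanceOptimal D →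
      (∃ (s : ∀ i, Fin (K i)) (π : B.Policy), B.IsBalancedIndex D s π) ∧
      ∀ (s : ∀ i, Fin (K i)) (π : B.Policy), B.IsBalancedIndex D s π →
        (∀ (s' : ∀ i, Fin (K i)) (π' : B.Policy),
          Filter.limsup (fun T : ℕ => π'.average s' T) Filter.atTop ≤
            2 * Filter.liminf (fun T : ℕ => π.average s T) Filter.atTop) ∧
        (∀ x : ∀ i, Fin (K i) → ℕ → ℝ, B.WhittleFeasible x →
          B.whittleObj x ≤ 2 * Filter.liminf (fun T : ℕ => π.average s T) Filter.atTop) :=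
  ⟨B.exists_balanceOptimal, fun D hD => ⟨B.exists_isBalancedIndex D, fun _ _ hπ =>
    ⟨fun s' π' => (hD.1.limsup_average_le π' s').trans (hD.balanceObj_le hπ),
      fun _ hx => (hD.1.whittleObj_le hx).trans (hD.balanceObj_le hπ)⟩⟩⟩
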